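/- Let $H\in(1/2,3/4)$ and let $B^H=(B^H_t)_{t\ge 0}$ be a fractional Brownian motion with Hurst parameter $H$ on a probability space $(\Omega,\mathcal F,P)$, i.e. a continuous centered Gaussian process with $E(B^H_sB^H_t)=\tfrac12\left(t^{2H}+s^{2H}-|t-s|^{2H}\right)$. For $f:\mathbb R\to\mathbb R$ put $$Mf(x)=C_H\int_{\mathbb R}\frac{f(t)}{|t-x|^{3/2-H}}\,dt,\qquad C_H=\frac{[\Gamma(2H+1)\sin(\pi H)]^{1/2}}{2\,\Gamma(H-\frac12)\cos\left(\frac{\pi}{2}(H-\frac12)\right)},$$ and let $L^2_H(\mathbb R)$ be the space of those $f$ for which $Mf$ is defined almost everywhere by an absolutely convergent integral and $\|f\|_{L^2_H}:=\|Mf\|_{L^2(\mathbb R)}<\infty$. For $f\in L^2_H(\mathbb R)$ supported in $[0,\infty)$, the Wiener integral $\int f\,dB^H$ is the limit in $L^2(P)$ of $\sum_j a_jB^H_{t_j}$ along step functions $\sum_j a_j\chi_{[0,t_j]}$ that converge to $f$ in $\|\cdot\|_{L^2_H}$. Let $\sigma:[0,1]\to\mathbb R$ be a bounded measurable (deterministic,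 time-varying) function. For $N\ge 1$ and $0\le k<N$ set $f_k=\sigma\,\chi_{[k/N,(k+1)/N]}$, $$\eta_k=\int_{\mathbb R} f_k\,dB^H,\qquad \tilde\theta_N=N^{2H-1}\sum_{k=0}^{N-1}E(\eta_k^2),\qquad X_N=\sqrt N\left(N^{2H-1}\sum_{k=0}^{N-1}\eta_k^2-\tilde\theta_N\right).$$ Then the Wiener integrals $\eta_k$ exist, the limit $$\sigma^2_{H,2,*}=\lim_{N\to\infty}N^{4H-1}\cdot 2\sum_{k=0}^{N-1}\sum_{k'=0}^{N-1}\left(\int_{\mathbb R}Mf_k(s)\,Mf_{k'}(s)\,ds\right)^2$$ exists in $[0,\infty)$, and $X_N$ converges in law to $\mathcal N(0,\sigma^2_{H,2,*})$ as $N\to\infty$ (where $\mathcal N(0,0)$ is the point mass at $0$). -/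

import Mathlib

open MeasureTheory ProbabilityTheory Filter Set
open scoped Topology NNReal ENNReal

noncomputable section

namespace FBMVolatility

/-- `B` is a fractional Brownian motion with Hurst parameter `H`, indexed by `[0, ∞)`, on the
probability space `(Ω, P)`: an (almost surely) continuous centered Gaussian process with
`E(B_s B_t) = (t^{2H} + s^{2H} - |t - s|^{2H}) / 2`. -/
structure IsFractionalBrownianMotion {Ω : Type*} [MeasurableSpace Ω] (H : ℝ)
    (B : ℝ≥0 → Ω → ℝ) (P : Measure Ω) : Prop where
  isGaussianProcess : IsGaussianProcess B P
  centered : ∀ t, ∫ ω, B t ω ∂P = 0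
  covariance : ∀ s t : ℝ≥0, ∫ ω, B s ω * B t ω ∂P =
    ((t : ℝ) ^ (2 * H) + (s : ℝ) ^ (2 * H) - |(t : ℝ) - (s : ℝ)| ^ (2 * H)) / 2
  continuous_paths : ∀ᵐ ω ∂P, Continuous fun t => B t ω

/-- The normalizing constant `C_H` of the operator `M`, for `1/2 < H < 1`. -/
def constC (H : ℝ) : ℝ :=
  √(Real.Gamma (2 * H + 1) * Real.sin (Real.pi * H)) /
    (2 * Real.Gamma (H - 1 / 2) * Real.cos (Real.pi * (H - 1 / 2) / 2))

/-- The operator `M`, for `1/2 < H < 1`: `(M f)(x) = C_H ∫ f(t) / |t - x|^{3/2 - H} dt`. -/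
def opM (H : ℝ) (f : ℝ → ℝ) (x : ℝ) : ℝ :=
  constC H * ∫ t, f t / |t - x| ^ (3 / 2 - H)

/-- `f ∈ L²_H(ℝ)`, for `1/2 < H < 1`: the integral defining `M f` converges absolutely almost
everywhere, and `M f ∈ L²(ℝ)`. -/
structure MemL2H (H : ℝ) (f : ℝ → ℝ) : Prop where
  integrable : ∀ᵐ x : ℝ, Integrable fun t => f t / |t - x| ^ (3 / 2 - H)
  memLp : MemLp (opM H f) 2 volume

/-- The step function `∑ⱼ aⱼ χ_{[0, tⱼ]}`, coded by the finitely supported family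
`c = (tⱼ ↦ aⱼ)`. -/
def stepFun (c : ℝ≥0 →₀ ℝ) (s : ℝ) : ℝ :=
  c.sum fun t a => a * (Icc (0 : ℝ) (t : ℝ)).indicator (fun _ => 1) s

/-- The integral `∑ⱼ aⱼ B_{tⱼ}` of the step function `∑ⱼ aⱼ χ_{[0, tⱼ]}` with respect to `B`. -/
def stepIntegral {Ω : Type*} (B : ℝ≥0 → Ω → ℝ) (c : ℝ≥0 →₀ ℝ) (ω : Ω) : ℝ :=
  c.sum fun t a => a * B t ω

/-- `Y` is (a version of) the Wiener integral `∫ f dB` of the deterministic function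
`f ∈ L²_H(ℝ)` with respect to the fractional Brownian motion `B`: the `L²(P)`-limit of the
integrals of step functions `φₙ` converging to `f` in the norm `‖φ‖ = ‖M φ‖_{L²(ℝ)}`. -/
structure IsWienerIntegral {Ω : Type*} [MeasurableSpace Ω] (H : ℝ) (B : ℝ≥0 → Ω → ℝ)
    (P : Measure Ω) (f : ℝ → ℝ) (Y : Ω → ℝ) : Prop where
  memL2H : MemL2H H f
  memLp : MemLp Y 2 P
  exists_approx : ∃ c : ℕ → ℝ≥0 →₀ ℝ,
    Tendsto (fun n => eLpNorm (opM H fun s => stepFun (c n) s - f s) 2 volume) atTop (𝓝 0) ∧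
    Tendsto (fun n => eLpNorm (fun ω => stepIntegral B (c n) ω - Y ω) 2 P) atTop (𝓝 0)

/-- `f_k = σ · χ_{[k/N, (k+1)/N]}`. -/
def volPiece (σ : ℝ → ℝ) (N k : ℕ) : ℝ → ℝ :=
  (Icc ((k : ℝ) / N) (((k : ℝ) + 1) / N)).indicator σ

/-- `θ̃_N = ∑_{k < N} h^{1 - 2H} E(η_k²)` with `h = 1/N`, where `η N k` stands for the `k`-th
random variable `η_k` at mesh `1/N`. -/
def thetaTilde {Ω : Type*} [MeasurableSpace Ω] (H : ℝ) (P : Measure Ω) (η : ℕ → ℕ → Ω → ℝ)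
    (N : ℕ) : ℝ :=
  ∑ k ∈ Finset.range N, (1 / (N : ℝ)) ^ (1 - 2 * H) * ∫ ω, (η N k ω) ^ 2 ∂P

/-- `X_N = √N (∑_{k < N} h^{1 - 2H} η_k² - θ̃_N)` with `h = 1/N`. -/
def statX {Ω : Type*} [MeasurableSpace Ω] (H : ℝ) (P : Measure Ω) (η : ℕ → ℕ → Ω → ℝ)
    (N : ℕ) (ω : Ω) : ℝ :=
  √(N : ℝ) * (∑ k ∈ Finset.range N, (1 / (N : ℝ)) ^ (1 - 2 * H) * (η N k ω) ^ 2
    - thetaTilde H P η N)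

end FBMVolatility

end

/-!
The statement reduces to a central limit theorem for the squared norm of a Gaussian vector and to
the asymptotics of its covariance matrix.

*Covariances.* Two Riesz kernels `|x - t|^{H-3/2}` compose to a multiple of `|s - t|^{2H-2}`, and
`C_H` is normalized so that
`∫ Mf Mg = H (2H - 1) ∬ f(s) g(t) |s - t|^{2H-2} ds dt` for bounded `f`, `g` with bounded support
(`constC_sq_mul_rieszConst`, `integral_opM_mul_opM`). The right-hand side is `covForm H f g`. On
indicators of intervals it is the covariance of the increments of fractional Brownian motion
(`covForm_indicator_indicator`), so integration of step functions is an isometry. By Schur's test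
the form is bounded on `L²([0, 1])` (`covForm_self_le`), where step functions are dense: this gives
the existence of the Wiener integrals (`IsTame.exists_isWienerIntegral`). They depend linearly on
the integrand and are centered Gaussian with variance `‖Mf‖²`, hence the `η_k` form a Gaussian
vector whose covariance matrix `S_N` has the entries `covForm H f_k f_l`.

*Central limit theorem.* Diagonalizing `S_N`, the centered sum `∑ (η_k² - E η_k²)` has the law of
`∑ λᵢ (Zᵢ² - 1)` with independent standard Gaussian `Zᵢ` and the eigenvalues `λᵢ` of `S_N`. Its
characteristic function is a product, and the second order expansion of the factors gives a normal
limit as soon as the variance `2 ∑ λᵢ² = 2 ∑ S_N(k, l)²` converges after scaling while the largest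
eigenvalue becomes negligible (`tendstoInDistribution_centered_sq`). Here the scale is
`N^{2H-1/2}` and Schur's test bounds the eigenvalues by a multiple of `1 / N`
(`dotProduct_volCov_le`), since the pieces `f_k` are orthogonal in `L²` with squared norm
`O(1 / N)`; the product tends to `0` because `H < 3/4`.

*Variance.* Let `ρ_j` be the autocovariance `incrCov H j` of the increments at unit step. For `k`
the index of the cell that contains `x`, the rescaled covariance `N^{2H} S_N(k, k + j)` tends to
`σ(x)² ρ_j` for almost every `x`, by the Lebesgue differentiation theorem
(`ae_tendsto_cellCovSq`). As `|ρ_j| = O(|j|^{2H-2})` is square summable for `H < 3/4`, dominated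
convergence, first in `x` and then in `j`, yields the limit `2 (∫₀¹ σ⁴) ∑_j ρ_j²` of the scaled
variance (`tendsto_sum_cellCovSq`).
-/

namespace FBMVolatility

/-! ### Composition of Riesz kernels -/

/-- Euler's integral for the Beta function. -/
lemma lintegral_rpow_mul_one_sub_rpow {a b : ℝ} (ha : 0 < a) (hb : 0 < b) :
    ∫⁻ x in Ioo (0 : ℝ) 1, ENNReal.ofReal (x ^ (a - 1) * (1 - x) ^ (b - 1)) =
      ENNReal.ofReal (beta a b) := by
  have h := lintegral_betaPDF_eq_one ha hb
  rw [lintegral_betaPDF] at h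
  have hB := beta_pos ha hb
  simp_rw [mul_assoc, ENNReal.ofReal_mul (one_div_pos.2 hB).le] at h
  rw [lintegral_const_mul' _ _ ENNReal.ofReal_ne_top] at h
  rw [← mul_one (ENNReal.ofReal (beta a b)), ← h, ← mul_assoc, ← ENNReal.ofReal_mul hB.le,
    mul_one_div_cancel hB.ne', ENNReal.ofReal_one, one_mul]

/-- The substitution `y = 1 / u` turns the integral over `(1, ∞)` into a Beta integral. -/
lemma lintegral_Ioi_rieszKernel {α : ℝ} (hα : 0 < α) (hα' : α < 1 / 2) :
    ∫⁻ y in Ioi (1 : ℝ), ENNReal.ofReal (|y| ^ (α - 1) * |1 - y| ^ (α - 1)) =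
      ENNReal.ofReal (beta (1 - 2 * α) α) := by
  have himg : (fun u : ℝ => u⁻¹) '' Ioo (0 : ℝ) 1 = Ioi 1 := by
    rw [Set.image_inv_eq_inv, Set.inv_Ioo_0_left one_pos, inv_one]
  rw [← himg, lintegral_image_eq_lintegral_abs_deriv_mul (f' := fun u => -(u ^ 2)⁻¹)
    measurableSet_Ioo (fun u hu => (hasDerivAt_inv hu.1.ne').hasDerivWithinAt)
    inv_injective.injOn, ← lintegral_rpow_mul_one_sub_rpow (by linarith) hα]
  refine setLIntegral_congr_fun measurableSet_Ioo fun u hu => ?_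
  obtain ⟨h0, h1⟩ := hu
  rw [← ENNReal.ofReal_mul (abs_nonneg _)]
  congr 1
  have e1 : |1 - u⁻¹| = (1 - u) * u⁻¹ := by
    rw [abs_of_neg (by rw [sub_neg]; exact (one_lt_inv₀ h0).2 h1)]
    field_simp
    ring
  rw [e1, abs_neg, abs_of_pos (by positivity), abs_of_pos (by positivity),
    Real.mul_rpow (by linarith) (by positivity), Real.inv_rpow h0.le, ← Real.rpow_neg h0.le,
    ← Real.rpow_natCast, ← Real.rpow_neg h0.le]
  have : u ^ (1 - 2 * α - 1) = u ^ (-((2 : ℕ) : ℝ)) * u ^ (-(α - 1)) * u ^ (-(α - 1)) := by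
    rw [← Real.rpow_add h0, ← Real.rpow_add h0]
    congr 1
    push_cast
    ring
  rw [this]
  ring

/-- By the symmetry `y ↦ 1 - y` of the kernel, the integral over `(-∞, 0)` equals the one over
`(1, ∞)`. -/
lemma lintegral_Iio_rieszKernel {α : ℝ} (hα : 0 < α) (hα' : α < 1 / 2) :
    ∫⁻ y in Iio (0 : ℝ), ENNReal.ofReal (|y| ^ (α - 1) * |1 - y| ^ (α - 1)) =
      ENNReal.ofReal (beta (1 - 2 * α) α) := by
  have himg : (fun u : ℝ => 1 - u) '' Ioi (1 : ℝ) = Iio 0 := by simp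
  rw [← himg, lintegral_image_eq_lintegral_abs_deriv_mul (f' := fun _ => -1)
    measurableSet_Ioi (fun u _ => ((hasDerivAt_id' u).const_sub 1).hasDerivWithinAt)
    (sub_right_injective.injOn), ← lintegral_Ioi_rieszKernel hα hα']
  refine setLIntegral_congr_fun measurableSet_Ioi fun u _ => ?_
  simp [mul_comm]

/-- The total mass of the product of two Riesz kernels of order `α` with singularities at `0`
and `1`. -/
noncomputable def rieszConst (α : ℝ) : ℝ := beta α α + 2 * beta (1 - 2 * α) α

lemma rieszConst_pos {α : ℝ} (hα : 0 < α) (hα' : α < 1 / 2) : 0 < rieszConst α := by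
  have := beta_pos hα hα
  have := beta_pos (show 0 < 1 - 2 * α by linarith) hα
  unfold rieszConst
  positivity

lemma lintegral_rieszKernel_zero_one {α : ℝ} (hα : 0 < α) (hα' : α < 1 / 2) :
    ∫⁻ y : ℝ, ENNReal.ofReal (|y| ^ (α - 1) * |1 - y| ^ (α - 1)) =
      ENNReal.ofReal (rieszConst α) := by
  have h1 := beta_pos hα hα
  have h2 := beta_pos (show 0 < 1 - 2 * α by linarith) hα
  have hm : ∫⁻ y in Ioo (0 : ℝ) 1, ENNReal.ofReal (|y| ^ (α - 1) * |1 - y| ^ (α - 1)) =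
      ENNReal.ofReal (beta α α) := by
    rw [← lintegral_rpow_mul_one_sub_rpow hα hα]
    refine setLIntegral_congr_fun measurableSet_Ioo fun u hu => ?_
    rw [abs_of_pos hu.1, abs_of_pos (by linarith [hu.2])]
  rw [← lintegral_add_compl _ (measurableSet_Iio (a := (0 : ℝ))), compl_Iio,
    setLIntegral_congr Ioi_ae_eq_Ici.symm, ← Ioc_union_Ioi_eq_Ioi (zero_le_one (α := ℝ)),
    lintegral_union measurableSet_Ioi (Ioc_disjoint_Ioi le_rfl),
    setLIntegral_congr Ioo_ae_eq_Ioc.symm, hm, lintegral_Ioi_rieszKernel hα hα',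
    lintegral_Iio_rieszKernel hα hα', ← ENNReal.ofReal_add h1.le h2.le,
    ← ENNReal.ofReal_add h2.le (by positivity), rieszConst]
  congr 1
  ring

/-- Composition of Riesz kernels: two kernels of order `α` compose to a kernel of order `2α`. -/
lemma lintegral_rieszKernel_mul {α : ℝ} (hα : 0 < α) (hα' : α < 1 / 2) {s t : ℝ} (hst : s ≠ t) :
    ∫⁻ x : ℝ, ENNReal.ofReal (|s - x| ^ (α - 1) * |t - x| ^ (α - 1)) =
      ENNReal.ofReal (rieszConst α * |s - t| ^ (2 * α - 1)) := by
  have hd : t - s ≠ 0 := sub_ne_zero.2 hst.symm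
  have hd' : 0 < |t - s| := abs_pos.2 hd
  have himg : (fun y : ℝ => s + (t - s) * y) '' univ = univ := by
    rw [image_univ, range_eq_univ]
    intro x
    exact ⟨(x - s) / (t - s), by field_simp; ring⟩
  rw [← setLIntegral_univ, ← himg, lintegral_image_eq_lintegral_abs_deriv_mul
    (f' := fun _ => t - s) MeasurableSet.univ
    (fun u _ => by
      simpa using (((hasDerivAt_id' u).const_mul (t - s)).const_add s).hasDerivWithinAt (s := univ))
    (fun x _ y _ h => by simpa [hd] using h), setLIntegral_univ]
  have key : ∀ y : ℝ, ENNReal.ofReal |t - s| *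
      ENNReal.ofReal (|s - (s + (t - s) * y)| ^ (α - 1) * |t - (s + (t - s) * y)| ^ (α - 1)) =
      ENNReal.ofReal (|t - s| ^ (2 * α - 1)) *
        ENNReal.ofReal (|y| ^ (α - 1) * |1 - y| ^ (α - 1)) := by
    intro y
    rw [← ENNReal.ofReal_mul hd'.le, ← ENNReal.ofReal_mul (by positivity)]
    congr 1
    have e1 : |s - (s + (t - s) * y)| = |t - s| * |y| := by
      rw [← abs_mul, ← abs_neg]; congr 1; ring
    have e2 : |t - (s + (t - s) * y)| = |t - s| * |1 - y| := by
      rw [← abs_mul]; congr 1; ring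
    have e3 : |t - s| ^ (2 * α - 1) = |t - s| * |t - s| ^ (α - 1) * |t - s| ^ (α - 1) := by
      nth_rewrite 2 [← Real.rpow_one |t - s|]
      rw [← Real.rpow_add hd', ← Real.rpow_add hd']
      congr 1
      ring
    rw [e1, e2, e3, Real.mul_rpow hd'.le (abs_nonneg _), Real.mul_rpow hd'.le (abs_nonneg _)]
    ring
  simp_rw [key]
  rw [lintegral_const_mul' _ _ ENNReal.ofReal_ne_top, lintegral_rieszKernel_zero_one hα hα',
    ← ENNReal.ofReal_mul (by positivity), abs_sub_comm, mul_comm]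

/-- The constant `C_H` is the one for which the composed kernel is `H (2H - 1) |s - t|^{2H-2}`,
the mixed second derivative of the fractional covariance. -/
lemma constC_sq_mul_rieszConst {H : ℝ} (hH : 1 / 2 < H) (hH' : H < 1) :
    constC H ^ 2 * rieszConst (H - 1 / 2) = H * (2 * H - 1) := by
  -- Euler's reflection formula at `α` and `2α` eliminates `Γ (1 - α)` and `Γ (1 - 2α)` from the
  -- Beta functions; what remains is the identity `1 + cos 2θ = 2 cos² θ`
  set α := H - 1 / 2 with hα
  have a0 : 0 < α := by linarith
  have a1 : α < 1 / 2 := by linarith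
  have hHα : H = α + 1 / 2 := by rw [hα]; ring
  have g1 : 0 < Real.Gamma α := Real.Gamma_pos_of_pos a0
  have g2 : 0 < Real.Gamma (2 * α) := Real.Gamma_pos_of_pos (by linarith)
  have g3 : 0 < Real.Gamma (1 - α) := Real.Gamma_pos_of_pos (by linarith)
  have pi0 := Real.pi_pos
  set θ := Real.pi * α / 2 with hθ
  have hc1 : 0 < Real.cos θ := by
    apply Real.cos_pos_of_mem_Ioo
    constructor <;> rw [hθ] <;> nlinarith
  have hc2 : 0 < Real.cos (2 * θ) := by
    apply Real.cos_pos_of_mem_Ioo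
    constructor <;> rw [hθ] <;> nlinarith
  have hs2 : 0 < Real.sin (2 * θ) := by
    apply Real.sin_pos_of_pos_of_lt_pi <;> rw [hθ] <;> nlinarith
  have r1 := Real.Gamma_mul_Gamma_one_sub α
  have r2 := Real.Gamma_mul_Gamma_one_sub (2 * α)
  have e1 : Real.pi * α = 2 * θ := by rw [hθ]; ring
  have e2 : Real.pi * (2 * α) = 2 * (2 * θ) := by rw [hθ]; ring
  rw [e1] at r1
  rw [e2, Real.sin_two_mul (2 * θ)] at r2
  have hsin : Real.sin (Real.pi * H) = Real.cos (2 * θ) := by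
    rw [hHα, mul_add, ← e1]
    have : Real.pi * (1 / 2) = Real.pi / 2 := by ring
    rw [this, Real.sin_add_pi_div_two]
  have hG : Real.Gamma (2 * H + 1) = (2 * α + 1) * (2 * α) * Real.Gamma (2 * α) := by
    have : 2 * H + 1 = (2 * α + 1) + 1 := by rw [hHα]; ring
    rw [this, Real.Gamma_add_one (by linarith), Real.Gamma_add_one (by linarith)]
    ring
  have hB : rieszConst α =
      Real.Gamma α ^ 2 / Real.Gamma (2 * α) * (2 * Real.cos θ ^ 2 / Real.cos (2 * θ)) := by
    have q1 : Real.Gamma (1 - α) = Real.pi / Real.sin (2 * θ) / Real.Gamma α := by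
      field_simp; field_simp at r1; linarith
    have q2 : Real.Gamma (1 - 2 * α) =
        Real.pi / (2 * Real.sin (2 * θ) * Real.cos (2 * θ)) / Real.Gamma (2 * α) := by
      rw [← r2]; field_simp
    have e3 : 1 - 2 * α + α = 1 - α := by ring
    have e4 : α + α = 2 * α := by ring
    rw [rieszConst, beta, beta, e3, e4, q1, q2]
    have := Real.cos_sq θ
    have hcc : Real.cos (2 * θ) = 2 * Real.cos θ ^ 2 - 1 := Real.cos_two_mul θ
    field_simp
    linarith
  have hcos : Real.pi * (H - 1 / 2) / 2 = θ := rfl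
  rw [constC, div_pow, Real.sq_sqrt (by rw [hsin, hG]; positivity), hsin, hcos, hG, hB, ← hα]
  rw [hHα]
  field_simp
  ring

/-! ### The kernel of fractional noise and its bilinear form -/

lemma hasDerivAt_abs_rpow {q x : ℝ} (hx : x ≠ 0) :
    HasDerivAt (fun x : ℝ => |x| ^ q) (q * (SignType.sign x * |x| ^ (q - 1))) x := by
  have h := (hasDerivAt_abs hx).rpow_const (p := q) (Or.inl (abs_ne_zero.2 hx))
  convert h using 1
  ring

lemma hasDerivAt_sign_mul_abs_rpow {p x : ℝ} (hx : x ≠ 0) :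
    HasDerivAt (fun x : ℝ => SignType.sign x * |x| ^ p) (p * |x| ^ (p - 1)) x := by
  rcases lt_or_gt_of_ne hx with h | h
  · have h1 := (hasDerivAt_abs_rpow (q := p) hx).neg
    rw [sign_neg h] at h1
    have h2 : (fun x : ℝ => (SignType.sign x : ℝ) * |x| ^ p) =ᶠ[𝓝 x] -(fun x : ℝ => |x| ^ p) := by
      filter_upwards [Iio_mem_nhds h] with y hy
      simp [sign_neg (show y < 0 from hy)]
    refine HasDerivAt.congr_of_eventuallyEq ?_ h2
    simpa using h1
  · have h1 := hasDerivAt_abs_rpow (q := p) hx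
    rw [sign_pos h] at h1
    have h2 : (fun x : ℝ => (SignType.sign x : ℝ) * |x| ^ p) =ᶠ[𝓝 x] (fun x : ℝ => |x| ^ p) := by
      filter_upwards [Ioi_mem_nhds h] with y hy
      simp [sign_pos (show 0 < y from hy)]
    refine HasDerivAt.congr_of_eventuallyEq ?_ h2
    simpa using h1

lemma continuous_sign_mul_abs_rpow {p : ℝ} (hp : 0 < p) :
    Continuous fun x : ℝ => (SignType.sign x : ℝ) * |x| ^ p := by
  rw [continuous_iff_continuousAt]
  intro x
  by_cases hx : x = 0
  · subst hx
    have h0 : Tendsto (fun x : ℝ => |x| ^ p) (𝓝 0) (𝓝 0) := by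
      have : Continuous fun x : ℝ => |x| ^ p := continuous_abs.rpow_const fun _ => Or.inr hp.le
      simpa [Real.zero_rpow hp.ne'] using this.tendsto 0
    rw [ContinuousAt]
    simp only [sign_zero, SignType.coe_zero, zero_mul]
    refine squeeze_zero_norm (fun x => ?_) h0
    rw [norm_mul, Real.norm_of_nonneg (by positivity : 0 ≤ |x| ^ p)]
    refine mul_le_of_le_one_left (by positivity) ?_
    rcases SignType.sign x with _ | _ | _ <;> simp
  · exact (hasDerivAt_sign_mul_abs_rpow hx).continuousAt

lemma intervalIntegrable_abs_rpow {p : ℝ} (hp : 0 < p) (a b : ℝ) :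
    IntervalIntegrable (fun x : ℝ => |x| ^ (p - 1)) volume a b := by
  have h0 : ∀ c : ℝ, 0 ≤ c → IntervalIntegrable (fun x : ℝ => |x| ^ (p - 1)) volume 0 c := by
    intro c hc
    refine (intervalIntegral.intervalIntegrable_rpow' (r := p - 1) (by linarith)).congr ?_
    intro x hx
    rw [uIoc_of_le hc] at hx
    simp only [abs_of_pos hx.1]
  have h1 : ∀ c : ℝ, IntervalIntegrable (fun x : ℝ => |x| ^ (p - 1)) volume 0 c := by
    intro c
    rcases le_total 0 c with hc | hc
    · exact h0 c hc
    · have := (IntervalIntegrable.iff_comp_neg).1 (h0 (-c) (by linarith))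
      simpa using this
  exact (h1 a).symm.trans (h1 b)

lemma integral_abs_rpow {p : ℝ} (hp : 0 < p) (a b : ℝ) :
    ∫ x in a..b, |x| ^ (p - 1) =
      (SignType.sign b * |b| ^ p - SignType.sign a * |a| ^ p) / p := by
  have h := MeasureTheory.integral_eq_of_hasDerivAt_off_countable
    (f := fun x : ℝ => (SignType.sign x : ℝ) * |x| ^ p) (f' := fun x => p * |x| ^ (p - 1))
    (a := a) (b := b) (s := {0}) (countable_singleton 0)
    (continuous_sign_mul_abs_rpow hp).continuousOn
    (fun x hx => hasDerivAt_sign_mul_abs_rpow hx.2)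
    ((intervalIntegrable_abs_rpow hp a b).const_mul p)
  rw [intervalIntegral.integral_const_mul] at h
  rw [← h]
  field_simp

lemma integral_sign_mul_abs_rpow {p : ℝ} (hp : 0 < p) (a b : ℝ) :
    ∫ x in a..b, (SignType.sign x : ℝ) * |x| ^ p = (|b| ^ (p + 1) - |a| ^ (p + 1)) / (p + 1) := by
  have hc := continuous_sign_mul_abs_rpow hp
  have h := MeasureTheory.integral_eq_of_hasDerivAt_off_countable
    (f := fun x : ℝ => |x| ^ (p + 1)) (f' := fun x => (p + 1) * (SignType.sign x * |x| ^ p))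
    (a := a) (b := b) (s := {0}) (countable_singleton 0)
    (continuous_abs.rpow_const fun _ => Or.inr (by linarith)).continuousOn
    (fun x hx => by simpa using hasDerivAt_abs_rpow (q := p + 1) hx.2)
    ((hc.intervalIntegrable a b).const_mul (p + 1))
  rw [intervalIntegral.integral_const_mul] at h
  rw [← h]
  field_simp

lemma intervalIntegrable_abs_sub_rpow {p : ℝ} (hp : 0 < p) (s a b : ℝ) :
    IntervalIntegrable (fun t : ℝ => |s - t| ^ (p - 1)) volume a b := by
  have := (intervalIntegrable_abs_rpow hp (s - a) (s - b)).comp_sub_left s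
  simpa using this

lemma integrableOn_abs_sub_rpow {p : ℝ} (hp : 0 < p) (s a b : ℝ) :
    IntegrableOn (fun t : ℝ => |s - t| ^ (p - 1)) (Icc a b) := by
  rcases le_total a b with h | h
  · rw [integrableOn_Icc_iff_integrableOn_Ioc, ← intervalIntegrable_iff_integrableOn_Ioc_of_le h]
    exact intervalIntegrable_abs_sub_rpow hp s a b
  · rw [integrableOn_Icc_iff_integrableOn_Ioc, Ioc_eq_empty h.not_gt]
    exact integrableOn_empty

lemma integral_abs_sub_rpow {p : ℝ} (hp : 0 < p) (s a b : ℝ) :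
    ∫ t in a..b, |s - t| ^ (p - 1) =
      (SignType.sign (s - a) * |s - a| ^ p - SignType.sign (s - b) * |s - b| ^ p) / p := by
  rw [intervalIntegral.integral_comp_sub_left (fun x => |x| ^ (p - 1)), integral_abs_rpow hp]

/-- The function `x ↦ sign x * |x| ^ p` is `p`-Hölder with constant `2`. -/
lemma sign_mul_abs_rpow_sub_le {p : ℝ} (hp : 0 < p) (hp1 : p ≤ 1) {x y : ℝ} (h : y ≤ x) :
    SignType.sign x * |x| ^ p - SignType.sign y * |y| ^ p ≤ 2 * (x - y) ^ p := by
  have hn : 0 ≤ (x - y) ^ p := Real.rpow_nonneg (by linarith) _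
  have aux : ∀ u v : ℝ, 0 ≤ u → u ≤ v → v ^ p - u ^ p ≤ 2 * (v - u) ^ p := by
    intro u v hu huv
    have h1 := Real.rpow_add_le_add_rpow hu (sub_nonneg.2 huv) hp.le hp1
    rw [add_sub_cancel] at h1
    have h2 : 0 ≤ (v - u) ^ p := Real.rpow_nonneg (by linarith) _
    linarith
  have s0 : ∀ z : ℝ, 0 ≤ z → (SignType.sign z : ℝ) * |z| ^ p = z ^ p := by
    intro z hz
    rcases hz.eq_or_lt with rfl | hz
    · simp [Real.zero_rpow hp.ne']
    · simp [sign_pos hz, abs_of_pos hz]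
  have s1 : ∀ z : ℝ, z ≤ 0 → (SignType.sign z : ℝ) * |z| ^ p = -(-z) ^ p := by
    intro z hz
    rcases hz.eq_or_lt with rfl | hz
    · simp [Real.zero_rpow hp.ne']
    · simp [sign_neg hz, abs_of_neg hz]
  rcases le_total 0 x with hx | hx
  · rcases le_total 0 y with hy | hy
    · rw [s0 x hx, s0 y hy]
      exact aux y x hy h
    · rw [s0 x hx, s1 y hy]
      have h1 := Real.rpow_le_rpow hx (by linarith : x ≤ x - y) hp.le
      have h2 := Real.rpow_le_rpow (by linarith : 0 ≤ -y) (by linarith : -y ≤ x - y) hp.le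
      linarith
  · rw [s1 x hx, s1 y (h.trans hx)]
    have := aux (-x) (-y) (by linarith) (by linarith)
    rw [show -y - -x = x - y by ring] at this
    linarith

lemma setIntegral_abs_sub_rpow_le {p : ℝ} (hp : 0 < p) (hp1 : p ≤ 1) {a b : ℝ} (hab : a ≤ b)
    (s : ℝ) : ∫ t in Icc a b, |s - t| ^ (p - 1) ≤ 2 / p * (b - a) ^ p := by
  rw [integral_Icc_eq_integral_Ioc, ← intervalIntegral.integral_of_le hab,
    integral_abs_sub_rpow hp, div_mul_eq_mul_div]
  have := sign_mul_abs_rpow_sub_le hp hp1 (show s - b ≤ s - a by linarith)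
  rw [show s - a - (s - b) = b - a by ring] at this
  gcongr

/-- The kernel `H (2H - 1) |s - t|^{2H-2}`, the mixed second derivative of the covariance of
fractional Brownian motion. -/
noncomputable def covKernel (H : ℝ) (p : ℝ × ℝ) : ℝ :=
  H * (2 * H - 1) * |p.1 - p.2| ^ (2 * H - 2)

/-- The bilinear form `∬ f(s) g(t) H (2H - 1) |s - t|^{2H-2} ds dt`. -/
noncomputable def covForm (H : ℝ) (f g : ℝ → ℝ) : ℝ :=
  ∫ p : ℝ × ℝ, f p.1 * g p.2 * covKernel H p

/-- Bounded measurable functions with bounded support. The bounds hold everywhere; measurability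
is only required up to null sets. -/
structure IsTame (f : ℝ → ℝ) : Prop where
  aemeasurable : AEMeasurable f
  bounded : ∃ C, ∀ x, |f x| ≤ C
  support : ∃ R, ∀ x, x ∉ Icc (-R) R → f x = 0

namespace IsTame

variable {f g : ℝ → ℝ}

lemma exists_bound (hf : IsTame f) : ∃ C, 0 ≤ C ∧ ∀ x, |f x| ≤ C := by
  obtain ⟨C, hC⟩ := hf.bounded
  exact ⟨C, (abs_nonneg _).trans (hC 0), hC⟩

lemma zero : IsTame 0 := ⟨aemeasurable_const, ⟨0, by simp⟩, ⟨0, by simp⟩⟩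

lemma add (hf : IsTame f) (hg : IsTame g) : IsTame (f + g) := by
  obtain ⟨C, hC⟩ := hf.bounded
  obtain ⟨D, hD⟩ := hg.bounded
  obtain ⟨R, hR⟩ := hf.support
  obtain ⟨S, hS⟩ := hg.support
  refine ⟨hf.aemeasurable.add hg.aemeasurable, ⟨C + D, fun x => ?_⟩, ⟨max R S, fun x hx => ?_⟩⟩
  · exact (abs_add_le _ _).trans (add_le_add (hC x) (hD x))
  · have h1 : x ∉ Icc (-R) R := fun h => hx
      (Icc_subset_Icc (neg_le_neg (le_max_left _ _)) (le_max_left _ _) h)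
    have h2 : x ∉ Icc (-S) S := fun h => hx
      (Icc_subset_Icc (neg_le_neg (le_max_right _ _)) (le_max_right _ _) h)
    simp [hR x h1, hS x h2]

lemma mul (hf : IsTame f) (hg : IsTame g) : IsTame (f * g) := by
  obtain ⟨C, hC0, hC⟩ := hf.exists_bound
  obtain ⟨D, hD⟩ := hg.bounded
  obtain ⟨R, hR⟩ := hf.support
  refine ⟨hf.aemeasurable.mul hg.aemeasurable, ⟨C * D, fun x => ?_⟩, ⟨R, fun x hx => ?_⟩⟩
  · rw [Pi.mul_apply, abs_mul]
    exact mul_le_mul (hC x) (hD x) (abs_nonneg _) hC0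
  · simp [hR x hx]

lemma const_smul (hf : IsTame f) (c : ℝ) : IsTame (c • f) := by
  obtain ⟨C, hC⟩ := hf.bounded
  obtain ⟨R, hR⟩ := hf.support
  refine ⟨hf.aemeasurable.const_smul c, ⟨|c| * C, fun x => ?_⟩, ⟨R, fun x hx => ?_⟩⟩
  · rw [Pi.smul_apply, smul_eq_mul, abs_mul]
    exact mul_le_mul_of_nonneg_left (hC x) (abs_nonneg _)
  · simp [hR x hx]

lemma sub (hf : IsTame f) (hg : IsTame g) : IsTame (f - g) := by
  have := hf.add (hg.const_smul (-1))
  simpa [sub_eq_add_neg] using this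

lemma abs (hf : IsTame f) : IsTame fun x => |f x| := by
  obtain ⟨C, hC⟩ := hf.bounded
  obtain ⟨R, hR⟩ := hf.support
  exact ⟨hf.aemeasurable.norm, ⟨C, fun x => by simpa using hC x⟩,
    ⟨R, fun x hx => by simp [hR x hx]⟩⟩

lemma sum {ι : Type*} (s : Finset ι) {F : ι → ℝ → ℝ} (hF : ∀ i ∈ s, IsTame (F i)) :
    IsTame (∑ i ∈ s, F i) := by
  classical
  induction s using Finset.induction_on with
  | empty => simpa using zero
  | insert i s hi ih =>
    rw [Finset.sum_insert hi]
    exact (hF i (by simp)).add (ih fun j hj => hF j (by simp [hj]))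

lemma of_le_indicator {C a b : ℝ} (hf : AEMeasurable f)
    (h : ∀ x, |f x| ≤ C) (h0 : ∀ x, x ∉ Icc a b → f x = 0) : IsTame f := by
  refine ⟨hf, ⟨C, h⟩, ⟨max |a| |b|, fun x hx => h0 x fun hx' => hx ?_⟩⟩
  constructor
  · have := neg_abs_le a
    have := le_max_left |a| |b|
    linarith [hx'.1]
  · have := le_abs_self b
    have := le_max_right |a| |b|
    linarith [hx'.2]

lemma indicator_Icc (a b : ℝ) : IsTame ((Icc a b).indicator fun _ => 1) :=
  of_le_indicator (C := 1) (a := a) (b := b)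
    (measurable_const.indicator measurableSet_Icc).aemeasurable
    (fun x => by by_cases hx : x ∈ Icc a b <;> simp [hx]) (fun x hx => by simp [hx])

lemma integrable (hf : IsTame f) : Integrable f := by
  obtain ⟨C, hC⟩ := hf.bounded
  obtain ⟨R, hR⟩ := hf.support
  have h1 : IntegrableOn f (Icc (-R) R) :=
    Measure.integrableOn_of_bounded (M := C) (by simp) hf.aemeasurable.aestronglyMeasurable
      (Eventually.of_forall fun x => by simpa using hC x)
  exact (integrableOn_iff_integrable_of_support_subset fun x hx => by
    by_contra h; exact hx (hR x h)).1 h1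

/-- A tame function is integrable against every locally integrable Riesz kernel. -/
lemma integrable_mul_rpow (hf : IsTame f) {p : ℝ} (hp : 0 < p) (s : ℝ) :
    Integrable fun t => f t * |s - t| ^ (p - 1) := by
  obtain ⟨C, hC⟩ := hf.bounded
  obtain ⟨R, hR⟩ := hf.support
  have h1 : IntegrableOn (fun t => f t * |s - t| ^ (p - 1)) (Icc (-R) R) :=
    (integrableOn_abs_sub_rpow hp s (-R) R).bdd_mul
      hf.aemeasurable.aestronglyMeasurable.restrict
      (Eventually.of_forall fun x => by simpa using hC x)
  exact (integrableOn_iff_integrable_of_support_subset fun x hx => by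
    by_contra h; exact hx (by simp [hR x h])).1 h1

end IsTame

lemma measurable_covKernel (H : ℝ) : Measurable (covKernel H) := by
  unfold covKernel
  fun_prop

lemma covKernel_nonneg {H : ℝ} (hH : 1 / 2 < H) (p : ℝ × ℝ) : 0 ≤ covKernel H p := by
  have : 0 ≤ 2 * H - 1 := by linarith
  unfold covKernel
  positivity

lemma covKernel_swap (H : ℝ) (p : ℝ × ℝ) : covKernel H p.swap = covKernel H p := by
  simp [covKernel, abs_sub_comm]

lemma setIntegral_covKernel_le {H : ℝ} (hH : 1 / 2 < H) (hH' : H < 1) {a b : ℝ} (hab : a ≤ b)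
    (s : ℝ) : ∫ t in Icc a b, covKernel H (s, t) ≤ 2 * H * (b - a) ^ (2 * H - 1) := by
  have h0 : 0 < 2 * H - 1 := by linarith
  have h := setIntegral_abs_sub_rpow_le h0 (by linarith) hab s
  simp only [covKernel, integral_const_mul]
  rw [show (2 * H - 2) = 2 * H - 1 - 1 by ring]
  calc _ ≤ H * (2 * H - 1) * (2 / (2 * H - 1) * (b - a) ^ (2 * H - 1)) := by gcongr
    _ = _ := by
      have h1 := h0.ne'
      generalize 2 * H - 1 = q at h1 ⊢
      field_simp

lemma integrableOn_covKernel {H : ℝ} (hH : 1 / 2 < H) (s a b : ℝ) :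
    IntegrableOn (fun t => covKernel H (s, t)) (Icc a b) := by
  have h := (integrableOn_abs_sub_rpow (show 0 < 2 * H - 1 by linarith) s a b).const_mul
    (H * (2 * H - 1))
  simp only [covKernel]
  rw [show (2 * H - 2) = 2 * H - 1 - 1 by ring]
  exact h

lemma integrableOn_covKernel_prod {H : ℝ} (hH : 1 / 2 < H) (hH' : H < 1) (a b : ℝ) :
    IntegrableOn (covKernel H) (Icc a b ×ˢ Icc a b) := by
  rcases lt_or_ge b a with hab | hab
  · simp [Icc_eq_empty hab.not_ge]
  rw [IntegrableOn, Measure.volume_eq_prod, ← Measure.prod_restrict,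
    integrable_prod_iff (measurable_covKernel H).aestronglyMeasurable]
  refine ⟨Eventually.of_forall fun s => integrableOn_covKernel hH s a b, ?_⟩
  refine Integrable.mono' (integrable_const (2 * H * (b - a) ^ (2 * H - 1))) ?_
    (Eventually.of_forall fun s => ?_)
  · exact ((measurable_covKernel H).aestronglyMeasurable.norm).integral_prod_right'
  · rw [Real.norm_of_nonneg (integral_nonneg fun _ => norm_nonneg _)]
    simp_rw [fun t => Real.norm_of_nonneg (covKernel_nonneg hH (s, t))]
    exact setIntegral_covKernel_le hH hH' hab s

lemma IsTame.aestronglyMeasurable_prod {f g : ℝ → ℝ} (hf : IsTame f) (hg : IsTame g) :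
    AEStronglyMeasurable (fun p : ℝ × ℝ => f p.1 * g p.2) :=
  hf.aemeasurable.aestronglyMeasurable.comp_fst.mul hg.aemeasurable.aestronglyMeasurable.comp_snd

lemma integrable_covForm {H : ℝ} (hH : 1 / 2 < H) (hH' : H < 1) {f g : ℝ → ℝ} (hf : IsTame f)
    (hg : IsTame g) : Integrable fun p : ℝ × ℝ => f p.1 * g p.2 * covKernel H p := by
  obtain ⟨C, hC0, hC⟩ := hf.exists_bound
  obtain ⟨D, hD⟩ := hg.bounded
  obtain ⟨R, hR⟩ := hf.support
  obtain ⟨S, hS⟩ := hg.support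
  set T := max R S
  have h1 : IntegrableOn (fun p : ℝ × ℝ => f p.1 * g p.2 * covKernel H p)
      (Icc (-T) T ×ˢ Icc (-T) T) := by
    refine (integrableOn_covKernel_prod hH hH' (-T) T).bdd_mul
      (hf.aestronglyMeasurable_prod hg).restrict (c := C * D)
      (Eventually.of_forall fun p => ?_)
    rw [norm_mul]
    exact mul_le_mul (hC _) (hD _) (norm_nonneg _) hC0
  refine (integrableOn_iff_integrable_of_support_subset fun p hp => ?_).1 h1
  by_contra h
  apply hp
  rw [mem_prod, not_and_or] at h
  rcases h with h | h
  · have : f p.1 = 0 := hR _ fun h' => h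
      (Icc_subset_Icc (neg_le_neg (le_max_left _ _)) (le_max_left _ _) h')
    simp [this]
  · have : g p.2 = 0 := hS _ fun h' => h
      (Icc_subset_Icc (neg_le_neg (le_max_right _ _)) (le_max_right _ _) h')
    simp [this]

/-! ### The scalar product of `L²_H` and the bilinear form -/

lemma div_abs_rpow_eq (H y : ℝ) (t x : ℝ) :
    y / |t - x| ^ (3 / 2 - H) = y * |x - t| ^ (H - 1 / 2 - 1) := by
  rw [abs_sub_comm, show H - 1 / 2 - 1 = -(3 / 2 - H) by ring, Real.rpow_neg (abs_nonneg _),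
    div_eq_mul_inv]

lemma opM_eq (H : ℝ) (f : ℝ → ℝ) (x : ℝ) :
    opM H f x = constC H * ∫ t, f t * |x - t| ^ (H - 1 / 2 - 1) := by
  simp_rw [opM, div_abs_rpow_eq]

lemma IsTame.integrable_div {f : ℝ → ℝ} (hf : IsTame f) {H : ℝ} (hH : 1 / 2 < H) (x : ℝ) :
    Integrable fun t => f t / |t - x| ^ (3 / 2 - H) := by
  simp_rw [div_abs_rpow_eq]
  exact hf.integrable_mul_rpow (by linarith) x

lemma aestronglyMeasurable_opM {f : ℝ → ℝ} (hf : IsTame f) (H : ℝ) :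
    AEStronglyMeasurable (opM H f) := by
  have : opM H f = fun x => constC H * ∫ t, f t * |x - t| ^ (H - 1 / 2 - 1) := by
    ext x; exact opM_eq H f x
  rw [this]
  refine AEStronglyMeasurable.const_mul ?_ _
  refine AEStronglyMeasurable.integral_prod_right' (μ := volume) (ν := volume)
    (f := fun p : ℝ × ℝ => f p.2 * |p.1 - p.2| ^ (H - 1 / 2 - 1)) ?_
  exact hf.aemeasurable.aestronglyMeasurable.comp_snd.mul
    (Measurable.aestronglyMeasurable (by fun_prop))

/-- The diagonal, where the composed kernel takes a junk value, is a null set. -/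
lemma ae_fst_ne_snd : ∀ᵐ p : ℝ × ℝ, p.1 ≠ p.2 := by
  rw [Measure.volume_eq_prod, Measure.ae_prod_iff_ae_ae]
  · refine Eventually.of_forall fun s => ?_
    have : ({s} : Set ℝ)ᶜ ∈ ae volume := compl_mem_ae_iff.2 (by simp)
    filter_upwards [this] with t ht h
    exact ht h.symm
  · exact (measurableSet_eq_fun measurable_fst measurable_snd).compl

/-- Absolute integrability of the triple integral behind the scalar product `⟨M f, M g⟩`. -/
lemma integrable_triple {H : ℝ} (hH : 1 / 2 < H) (hH' : H < 1) {f g : ℝ → ℝ} (hf : IsTame f)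
    (hg : IsTame g) :
    Integrable (fun q : (ℝ × ℝ) × ℝ => (f q.1.1 * g q.1.2) *
      (|q.1.1 - q.2| ^ (H - 1 / 2 - 1) * |q.1.2 - q.2| ^ (H - 1 / 2 - 1)))
      ((volume : Measure (ℝ × ℝ)).prod volume) := by
  have hm : AEStronglyMeasurable (fun q : (ℝ × ℝ) × ℝ => (f q.1.1 * g q.1.2) *
      (|q.1.1 - q.2| ^ (H - 1 / 2 - 1) * |q.1.2 - q.2| ^ (H - 1 / 2 - 1)))
      ((volume : Measure (ℝ × ℝ)).prod volume) := by
    refine AEStronglyMeasurable.mul ?_ (Measurable.aestronglyMeasurable (by fun_prop))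
    exact (hf.aestronglyMeasurable_prod hg).comp_fst
  refine ⟨hm, ?_⟩
  rw [hasFiniteIntegral_iff_enorm, lintegral_prod _ hm.enorm]
  have hk : 0 < H * (2 * H - 1) := mul_pos (by linarith) (by linarith)
  have hR := rieszConst_pos (α := H - 1 / 2) (by linarith) (by linarith)
  have h := (((integrable_covForm hH hH' hf hg).const_mul
    (rieszConst (H - 1 / 2) / (H * (2 * H - 1)))).2)
  rw [hasFiniteIntegral_iff_enorm] at h
  refine lt_of_le_of_lt (le_of_eq (lintegral_congr_ae ?_)) h
  filter_upwards [ae_fst_ne_snd] with p hp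
  have e : ∀ x : ℝ, ‖(f p.1 * g p.2) *
      (|p.1 - x| ^ (H - 1 / 2 - 1) * |p.2 - x| ^ (H - 1 / 2 - 1))‖ₑ =
      ‖f p.1 * g p.2‖ₑ *
        ENNReal.ofReal (|p.1 - x| ^ (H - 1 / 2 - 1) * |p.2 - x| ^ (H - 1 / 2 - 1)) := by
    intro x
    have h0 : 0 ≤ |p.1 - x| ^ (H - 1 / 2 - 1) * |p.2 - x| ^ (H - 1 / 2 - 1) := by positivity
    rw [enorm_mul, Real.enorm_of_nonneg h0]
  simp_rw [e]
  rw [lintegral_const_mul' _ _ enorm_ne_top, lintegral_rieszKernel_mul (by linarith) (by linarith)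
    hp, ← Real.enorm_of_nonneg (by positivity), ← enorm_mul]
  congr 1
  rw [covKernel, show 2 * (H - 1 / 2) - 1 = 2 * H - 2 by ring]
  have := hk.ne'
  generalize H * (2 * H - 1) = c at this ⊢
  field_simp

lemma integral_rieszKernel_mul {α : ℝ} (hα : 0 < α) (hα' : α < 1 / 2) {s t : ℝ} (hst : s ≠ t) :
    ∫ x : ℝ, |s - x| ^ (α - 1) * |t - x| ^ (α - 1) = rieszConst α * |s - t| ^ (2 * α - 1) := by
  have := rieszConst_pos hα hα'
  rw [integral_eq_lintegral_of_nonneg_ae (Eventually.of_forall fun x => by positivity)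
    (Measurable.aestronglyMeasurable (by fun_prop)), lintegral_rieszKernel_mul hα hα' hst,
    ENNReal.toReal_ofReal (by positivity)]

lemma opM_mul_opM {H : ℝ} (f g : ℝ → ℝ) (x : ℝ) :
    opM H f x * opM H g x = constC H ^ 2 * ∫ p : ℝ × ℝ, (f p.1 * g p.2) *
      (|p.1 - x| ^ (H - 1 / 2 - 1) * |p.2 - x| ^ (H - 1 / 2 - 1)) := by
  have h := integral_prod_mul (μ := volume) (ν := volume)
    (fun t => f t * |x - t| ^ (H - 1 / 2 - 1)) (fun t => g t * |x - t| ^ (H - 1 / 2 - 1))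
  rw [opM_eq, opM_eq, mul_mul_mul_comm, ← h, pow_two, Measure.volume_eq_prod]
  congr 1
  refine integral_congr_ae (Eventually.of_forall fun p => ?_)
  simp only [abs_sub_comm x]
  ring

lemma integrable_opM_mul_opM {H : ℝ} (hH : 1 / 2 < H) (hH' : H < 1) {f g : ℝ → ℝ}
    (hf : IsTame f) (hg : IsTame g) : Integrable fun x => opM H f x * opM H g x := by
  simp_rw [opM_mul_opM]
  exact (integrable_triple hH hH' hf hg).integral_prod_right.const_mul _

lemma IsTame.memL2H {H : ℝ} (hH : 1 / 2 < H) (hH' : H < 1) {f : ℝ → ℝ} (hf : IsTame f) :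
    MemL2H H f where
  integrable := Eventually.of_forall fun x => hf.integrable_div hH x
  memLp := by
    rw [memLp_two_iff_integrable_sq (aestronglyMeasurable_opM hf H)]
    simp_rw [pow_two]
    exact integrable_opM_mul_opM hH hH' hf hf

/-- On bounded functions with bounded support, the scalar product of `L²_H` is given by the
kernel `H (2H - 1) |s - t|^{2H-2}`. -/
lemma integral_opM_mul_opM {H : ℝ} (hH : 1 / 2 < H) (hH' : H < 1) {f g : ℝ → ℝ}
    (hf : IsTame f) (hg : IsTame g) : ∫ x, opM H f x * opM H g x = covForm H f g := by
  simp_rw [opM_mul_opM]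
  rw [integral_const_mul, ← integral_integral_swap (f := fun (p : ℝ × ℝ) (x : ℝ) =>
    (f p.1 * g p.2) * (|p.1 - x| ^ (H - 1 / 2 - 1) * |p.2 - x| ^ (H - 1 / 2 - 1)))
    (integrable_triple hH hH' hf hg), covForm, ← integral_const_mul]
  refine integral_congr_ae ?_
  filter_upwards [ae_fst_ne_snd] with p hp
  rw [integral_const_mul, integral_rieszKernel_mul (by linarith) (by linarith) hp, covKernel,
    ← constC_sq_mul_rieszConst hH hH', show 2 * (H - 1 / 2) - 1 = 2 * H - 2 by ring]
  ring

section covForm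

variable {H : ℝ} {f f' g g' : ℝ → ℝ}

lemma covForm_comm (H : ℝ) (f g : ℝ → ℝ) : covForm H f g = covForm H g f := by
  rw [covForm, Measure.volume_eq_prod, ← integral_prod_swap, covForm]
  refine integral_congr_ae (Eventually.of_forall fun p => ?_)
  simp only [covKernel_swap, Prod.fst_swap, Prod.snd_swap]
  ring

lemma covForm_add_left (hH : 1 / 2 < H) (hH' : H < 1) (hf : IsTame f) (hf' : IsTame f')
    (hg : IsTame g) : covForm H (f + f') g = covForm H f g + covForm H f' g := by
  rw [covForm, covForm, covForm, ← integral_add (integrable_covForm hH hH' hf hg)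
    (integrable_covForm hH hH' hf' hg)]
  refine integral_congr_ae (Eventually.of_forall fun p => ?_)
  simp only [Pi.add_apply]
  ring

lemma covForm_smul_left (H c : ℝ) (f g : ℝ → ℝ) :
    covForm H (c • f) g = c * covForm H f g := by
  rw [covForm, covForm, ← integral_const_mul]
  refine integral_congr_ae (Eventually.of_forall fun p => ?_)
  simp only [Pi.smul_apply, smul_eq_mul]
  ring

lemma covForm_smul_right (H c : ℝ) (f g : ℝ → ℝ) :
    covForm H f (c • g) = c * covForm H f g := by
  rw [covForm_comm, covForm_smul_left, covForm_comm]

lemma covForm_zero_left (H : ℝ) (g : ℝ → ℝ) : covForm H 0 g = 0 := by simp [covForm]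

lemma covForm_sum_left (hH : 1 / 2 < H) (hH' : H < 1) {ι : Type*} (s : Finset ι) {F : ι → ℝ → ℝ}
    (hF : ∀ i ∈ s, IsTame (F i)) (hg : IsTame g) :
    covForm H (∑ i ∈ s, F i) g = ∑ i ∈ s, covForm H (F i) g := by
  classical
  induction s using Finset.induction_on with
  | empty => simp [covForm_zero_left]
  | insert i s hi ih =>
    rw [Finset.sum_insert hi, Finset.sum_insert hi,
      covForm_add_left hH hH' (hF i (by simp)) (IsTame.sum s fun j hj => hF j (by simp [hj])) hg,
      ih fun j hj => hF j (by simp [hj])]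

lemma covForm_congr_ae (hf : f =ᵐ[volume] f') (hg : g =ᵐ[volume] g') :
    covForm H f g = covForm H f' g' := by
  refine integral_congr_ae ?_
  have h1 : ∀ᵐ p : ℝ × ℝ, f p.1 = f' p.1 := Measure.quasiMeasurePreserving_fst.ae hf
  have h2 : ∀ᵐ p : ℝ × ℝ, g p.2 = g' p.2 := Measure.quasiMeasurePreserving_snd.ae hg
  filter_upwards [h1, h2] with p h1 h2
  rw [h1, h2]

lemma abs_covForm_le (hH : 1 / 2 < H) (hH' : H < 1) (hf' : IsTame f') (hg' : IsTame g')
    (h1 : ∀ x, |f x| ≤ f' x) (h2 : ∀ x, |g x| ≤ g' x) :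
    |covForm H f g| ≤ covForm H f' g' := by
  refine (norm_integral_le_integral_norm
    (fun p : ℝ × ℝ => f p.1 * g p.2 * covKernel H p)).trans ?_
  refine integral_mono_of_nonneg (Eventually.of_forall fun p => norm_nonneg _)
    (integrable_covForm hH hH' hf' hg') (Eventually.of_forall fun p => ?_)
  simp only []
  rw [norm_mul, norm_mul, Real.norm_of_nonneg (covKernel_nonneg hH p)]
  refine mul_le_mul_of_nonneg_right ?_ (covKernel_nonneg hH p)
  exact mul_le_mul (h1 _) (h2 _) (norm_nonneg _) ((abs_nonneg _).trans (h1 _))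

/-- Schur's test for the kernel: integrating it over an interval gives at most
`2 H (b - a)^{2H-1}`, uniformly in the other variable. -/
lemma covForm_indicator_le (hH : 1 / 2 < H) (hH' : H < 1) (hf : IsTame f)
    (hf0 : ∀ x, 0 ≤ f x) {a b : ℝ} (hab : a ≤ b) :
    covForm H f ((Icc a b).indicator fun _ => 1) ≤ 2 * H * (b - a) ^ (2 * H - 1) * ∫ x, f x := by
  have hi := integrable_covForm hH hH' hf (IsTame.indicator_Icc a b)
  rw [Measure.volume_eq_prod] at hi
  rw [covForm, Measure.volume_eq_prod, integral_prod _ hi, ← integral_const_mul]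
  refine integral_mono hi.integral_prod_left (hf.integrable.const_mul _) fun s => ?_
  have e : ∀ t, f s * (Icc a b).indicator (fun _ => (1 : ℝ)) t * covKernel H (s, t) =
      f s * (Icc a b).indicator (fun t => covKernel H (s, t)) t := by
    intro t
    by_cases ht : t ∈ Icc a b <;> simp [ht]
  simp_rw [e]
  rw [integral_const_mul, integral_indicator measurableSet_Icc, mul_comm]
  exact mul_le_mul_of_nonneg_right (setIntegral_covKernel_le hH hH' hab s) (hf0 s)

/-- On functions supported in an interval, the form is dominated by the `L²` norm. -/
lemma covForm_self_le (hH : 1 / 2 < H) (hH' : H < 1) (hf : IsTame f) {a b : ℝ} (hab : a ≤ b)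
    (h0 : ∀ x, x ∉ Icc a b → f x = 0) :
    covForm H f f ≤ 2 * H * (b - a) ^ (2 * H - 1) * ∫ x, f x ^ 2 := by
  set u : ℝ → ℝ := (Icc a b).indicator fun _ => 1
  have hu : IsTame u := IsTame.indicator_Icc a b
  have hsq : IsTame (fun x => f x ^ 2) := by
    have e : (fun x => f x ^ 2) = f * f := by ext x; simp [pow_two]
    exact e ▸ hf.mul hf
  -- `f(s) f(t) ≤ (f(s)² + f(t)²) / 2` on the square, and the kernel is symmetric
  have key : covForm H f f ≤ covForm H (fun x => f x ^ 2) u := by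
    have e : covForm H (fun x => f x ^ 2) u =
        (covForm H (fun x => f x ^ 2) u + covForm H u (fun x => f x ^ 2)) / 2 := by
      rw [covForm_comm H u]; ring
    rw [e, covForm, covForm, covForm, ← integral_add (integrable_covForm hH hH' hsq hu)
      (integrable_covForm hH hH' hu hsq), ← integral_div]
    refine integral_mono (integrable_covForm hH hH' hf hf)
      (((integrable_covForm hH hH' hsq hu).add (integrable_covForm hH hH' hu hsq)).div_const 2)
      fun p => ?_
    simp only []
    rw [← add_mul, mul_div_right_comm]
    refine mul_le_mul_of_nonneg_right ?_ (covKernel_nonneg hH p)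
    have hu0 : ∀ x, 0 ≤ u x := fun x => indicator_nonneg (fun _ _ => zero_le_one) x
    by_cases h1 : p.1 ∈ Icc a b
    · by_cases h2 : p.2 ∈ Icc a b
      · simp only [u, indicator_of_mem h1, indicator_of_mem h2]
        nlinarith [sq_nonneg (f p.1 - f p.2)]
      · rw [h0 _ h2]
        have := mul_nonneg (sq_nonneg (f p.1)) (hu0 p.2)
        nlinarith
    · rw [h0 _ h1]
      have := mul_nonneg (hu0 p.1) (sq_nonneg (f p.2))
      nlinarith
  exact key.trans (covForm_indicator_le hH hH' hsq (fun x => sq_nonneg _) hab)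

/-- The form on indicators of intervals is the covariance of the increments of fractional
Brownian motion. -/
lemma covForm_indicator_indicator (hH : 1 / 2 < H) (hH' : H < 1) {a b c d : ℝ} (hab : a ≤ b)
    (hcd : c ≤ d) :
    covForm H ((Icc a b).indicator fun _ => 1) ((Icc c d).indicator fun _ => 1) =
      (|b - c| ^ (2 * H) + |a - d| ^ (2 * H) - |b - d| ^ (2 * H) - |a - c| ^ (2 * H)) / 2 := by
  have hp : 0 < 2 * H - 1 := by linarith
  have hi := integrable_covForm hH hH' (IsTame.indicator_Icc a b) (IsTame.indicator_Icc c d)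
  rw [Measure.volume_eq_prod] at hi
  rw [covForm, Measure.volume_eq_prod, integral_prod _ hi]
  have e : ∀ s, ∫ t, (Icc a b).indicator (fun _ => (1 : ℝ)) s *
      (Icc c d).indicator (fun _ => (1 : ℝ)) t * covKernel H (s, t) =
      (Icc a b).indicator (fun s => H * (SignType.sign (s - c) * |s - c| ^ (2 * H - 1) -
        SignType.sign (s - d) * |s - d| ^ (2 * H - 1))) s := by
    intro s
    have e' : ∀ t, (Icc a b).indicator (fun _ => (1 : ℝ)) s *
        (Icc c d).indicator (fun _ => (1 : ℝ)) t * covKernel H (s, t) =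
        (Icc a b).indicator (fun _ => (1 : ℝ)) s *
          (Icc c d).indicator (fun t => covKernel H (s, t)) t := by
      intro t
      by_cases ht : t ∈ Icc c d <;> simp [ht]
    simp_rw [e']
    rw [integral_const_mul, integral_indicator measurableSet_Icc]
    by_cases hs : s ∈ Icc a b
    · rw [indicator_of_mem hs, indicator_of_mem hs, one_mul, integral_Icc_eq_integral_Ioc,
        ← intervalIntegral.integral_of_le hcd]
      simp only [covKernel]
      rw [intervalIntegral.integral_const_mul, show (2 * H - 2) = 2 * H - 1 - 1 by ring,
        integral_abs_sub_rpow hp]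
      have h1 := hp.ne'
      generalize 2 * H - 1 = q at h1 ⊢
      field_simp
    · simp [hs]
  simp only []
  simp_rw [e]
  rw [integral_indicator measurableSet_Icc, integral_Icc_eq_integral_Ioc,
    ← intervalIntegral.integral_of_le hab, intervalIntegral.integral_const_mul]
  have hc := continuous_sign_mul_abs_rpow hp
  have hci : ∀ r, IntervalIntegrable
      (fun s : ℝ => (SignType.sign (s - r) : ℝ) * |s - r| ^ (2 * H - 1)) volume a b := fun r =>
    (hc.comp (continuous_id.sub continuous_const)).intervalIntegrable _ _
  rw [intervalIntegral.integral_sub (hci c) (hci d),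
    intervalIntegral.integral_comp_sub_right (fun s => (SignType.sign s : ℝ) * |s| ^ (2 * H - 1)),
    intervalIntegral.integral_comp_sub_right (fun s => (SignType.sign s : ℝ) * |s| ^ (2 * H - 1)),
    integral_sign_mul_abs_rpow hp, integral_sign_mul_abs_rpow hp, sub_add_cancel]
  have : H ≠ 0 := by linarith
  field_simp
  ring

end covForm

/-! ### Wiener integrals of step functions -/

lemma stepFun_eq_sum (c : ℝ≥0 →₀ ℝ) :
    stepFun c = ∑ t ∈ c.support, c t • (Icc (0 : ℝ) t).indicator fun _ => 1 := by
  ext s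
  simp [stepFun, Finsupp.sum]

lemma isTame_stepFun (c : ℝ≥0 →₀ ℝ) : IsTame (stepFun c) := by
  rw [stepFun_eq_sum]
  exact IsTame.sum _ fun t _ => (IsTame.indicator_Icc 0 (t : ℝ)).const_smul _

lemma stepFun_add (c d : ℝ≥0 →₀ ℝ) : stepFun (c + d) = stepFun c + stepFun d := by
  ext s
  exact Finsupp.sum_add_index' (by simp) (by intros; ring)

lemma stepFun_smul (a : ℝ) (c : ℝ≥0 →₀ ℝ) : stepFun (a • c) = a • stepFun c := by
  ext s
  simp only [stepFun, Pi.smul_apply, smul_eq_mul]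
  rw [Finsupp.sum_smul_index (by simp), Finsupp.mul_sum]
  simp only [mul_assoc]

lemma stepFun_sub (c d : ℝ≥0 →₀ ℝ) : stepFun (c - d) = stepFun c - stepFun d := by
  rw [sub_eq_add_neg, ← neg_one_smul ℝ d, stepFun_add, stepFun_smul]
  simp [sub_eq_add_neg]

lemma stepIntegral_add {Ω : Type*} (B : ℝ≥0 → Ω → ℝ) (c d : ℝ≥0 →₀ ℝ) :
    stepIntegral B (c + d) = stepIntegral B c + stepIntegral B d := by
  ext s
  exact Finsupp.sum_add_index' (by simp) (by intros; ring)

lemma stepIntegral_smul {Ω : Type*} (B : ℝ≥0 → Ω → ℝ) (a : ℝ) (c : ℝ≥0 →₀ ℝ) :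
    stepIntegral B (a • c) = a • stepIntegral B c := by
  ext s
  simp only [stepIntegral, Pi.smul_apply, smul_eq_mul]
  rw [Finsupp.sum_smul_index (by simp), Finsupp.mul_sum]
  simp only [mul_assoc]

lemma stepIntegral_sub {Ω : Type*} (B : ℝ≥0 → Ω → ℝ) (c d : ℝ≥0 →₀ ℝ) :
    stepIntegral B (c - d) = stepIntegral B c - stepIntegral B d := by
  rw [sub_eq_add_neg, ← neg_one_smul ℝ d, stepIntegral_add, stepIntegral_smul]
  simp [sub_eq_add_neg]

section WienerIntegrals

variable {Ω : Type*} [MeasurableSpace Ω] {B : ℝ≥0 → Ω → ℝ} {P : Measure Ω} {H : ℝ}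

lemma IsFractionalBrownianMotion.hasGaussianLaw_stepIntegral
    (hB : IsFractionalBrownianMotion H B P) (c : ℝ≥0 →₀ ℝ) :
    HasGaussianLaw (stepIntegral B c) P :=
  (hB.isGaussianProcess.smul c).hasGaussianLaw_fun_sum (I := c.support)

lemma IsFractionalBrownianMotion.integral_stepIntegral
    (hB : IsFractionalBrownianMotion H B P) (c : ℝ≥0 →₀ ℝ) :
    ∫ ω, stepIntegral B c ω ∂P = 0 := by
  simp only [stepIntegral, Finsupp.sum]
  rw [integral_finsetSum _ fun t _ =>
    ((hB.isGaussianProcess.hasGaussianLaw_eval t).integrable).const_mul _]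
  simp [integral_const_mul, hB.centered]

/-- The Itô-type isometry on step functions. -/
lemma IsFractionalBrownianMotion.integral_stepIntegral_sq (hH : 1 / 2 < H) (hH' : H < 1)
    (hB : IsFractionalBrownianMotion H B P) (c : ℝ≥0 →₀ ℝ) :
    ∫ ω, stepIntegral B c ω ^ 2 ∂P = covForm H (stepFun c) (stepFun c) := by
  have hχ : ∀ t : ℝ≥0, IsTame ((Icc (0 : ℝ) t).indicator fun _ => 1) :=
    fun t => IsTame.indicator_Icc 0 (t : ℝ)
  have h1 : covForm H (stepFun c) (stepFun c) =
      ∑ s ∈ c.support, ∑ t ∈ c.support, c s * (c t *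
        ((s : ℝ) ^ (2 * H) + (t : ℝ) ^ (2 * H) - |(s : ℝ) - (t : ℝ)| ^ (2 * H)) / 2) := by
    conv_lhs => rw [stepFun_eq_sum c]
    rw [covForm_sum_left hH hH' _ (fun t _ => (hχ t).const_smul _)
      (IsTame.sum _ fun t _ => (hχ t).const_smul _)]
    refine Finset.sum_congr rfl fun s _ => ?_
    rw [covForm_smul_left, covForm_comm, covForm_sum_left hH hH' _
      (fun t _ => (hχ t).const_smul _) (hχ s), Finset.mul_sum]
    refine Finset.sum_congr rfl fun t _ => ?_
    rw [covForm_smul_left, covForm_indicator_indicator hH hH' t.coe_nonneg s.coe_nonneg]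
    have : (2 : ℝ) * H ≠ 0 := by linarith
    simp only [sub_zero, zero_sub, abs_neg, NNReal.abs_eq, abs_zero,
      Real.zero_rpow this, abs_sub_comm (t : ℝ) (s : ℝ)]
    ring
  have h2 : ∀ ω, stepIntegral B c ω ^ 2 =
      ∑ s ∈ c.support, ∑ t ∈ c.support, c s * (c t * (B s ω * B t ω)) := by
    intro ω
    simp only [stepIntegral, Finsupp.sum, pow_two, Finset.sum_mul_sum]
    refine Finset.sum_congr rfl fun s _ => Finset.sum_congr rfl fun t _ => ?_
    ring
  have hint : ∀ s t, Integrable (fun ω => B s ω * B t ω) P := fun s t =>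
    (hB.isGaussianProcess.hasGaussianLaw_eval s).memLp_two.integrable_mul
      (hB.isGaussianProcess.hasGaussianLaw_eval t).memLp_two
  simp_rw [h2, h1]
  rw [integral_finsetSum _ fun s _ => integrable_finsetSum _ fun t _ =>
    ((hint s t).const_mul _).const_mul _]
  refine Finset.sum_congr rfl fun s _ => ?_
  rw [integral_finsetSum _ fun t _ => ((hint s t).const_mul _).const_mul _]
  refine Finset.sum_congr rfl fun t _ => ?_
  rw [integral_const_mul, integral_const_mul, hB.covariance, abs_sub_comm]
  ring

lemma IsFractionalBrownianMotion.map_stepIntegral (hH : 1 / 2 < H) (hH' : H < 1)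
    (hB : IsFractionalBrownianMotion H B P) (c : ℝ≥0 →₀ ℝ) :
    P.map (stepIntegral B c) =
      gaussianReal 0 (∫ x, opM H (stepFun c) x ^ 2).toNNReal := by
  have hg := hB.hasGaussianLaw_stepIntegral c
  rw [hg.map_eq_gaussianReal, hB.integral_stepIntegral, variance_of_integral_eq_zero
    hg.aemeasurable (hB.integral_stepIntegral c), hB.integral_stepIntegral_sq hH hH',
    ← integral_opM_mul_opM hH hH' (isTame_stepFun c) (isTame_stepFun c)]
  simp_rw [pow_two]

lemma eLpNorm_two_eq {α : Type*} [MeasurableSpace α] {μ : Measure α} {f : α → ℝ}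
    (hf : MemLp f 2 μ) : eLpNorm f 2 μ = ENNReal.ofReal (√(∫ x, f x ^ 2 ∂μ)) := by
  rw [hf.eLpNorm_eq_integral_rpow_norm (by norm_num) (by norm_num), Real.sqrt_eq_rpow]
  simp

lemma IsFractionalBrownianMotion.eLpNorm_stepIntegral (hH : 1 / 2 < H) (hH' : H < 1)
    (hB : IsFractionalBrownianMotion H B P) (c : ℝ≥0 →₀ ℝ) :
    eLpNorm (stepIntegral B c) 2 P = eLpNorm (opM H (stepFun c)) 2 volume := by
  rw [eLpNorm_two_eq (hB.hasGaussianLaw_stepIntegral c).memLp_two,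
    eLpNorm_two_eq ((isTame_stepFun c).memL2H hH hH').memLp, hB.integral_stepIntegral_sq hH hH',
    ← integral_opM_mul_opM hH hH' (isTame_stepFun c) (isTame_stepFun c)]
  simp_rw [pow_two]

lemma tendsto_integral_sq {α : Type*} [MeasurableSpace α] {μ : Measure α} {F : ℕ → α → ℝ}
    {f : α → ℝ} (hF : ∀ n, MemLp (F n) 2 μ) (hf : MemLp f 2 μ)
    (h : Tendsto (fun n => eLpNorm (F n - f) 2 μ) atTop (𝓝 0)) :
    Tendsto (fun n => ∫ x, F n x ^ 2 ∂μ) atTop (𝓝 (∫ x, f x ^ 2 ∂μ)) := by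
  have h1 := ((Lp.tendsto_Lp_iff_tendsto_eLpNorm'' F hF f hf).2 h).norm.pow 2
  have h2 : ∀ g : α → ℝ, ∀ hg : MemLp g 2 μ, ‖hg.toLp g‖ ^ 2 = ∫ x, g x ^ 2 ∂μ := by
    intro g hg
    rw [Lp.norm_toLp, eLpNorm_two_eq hg, ENNReal.toReal_ofReal (Real.sqrt_nonneg _),
      Real.sq_sqrt (integral_nonneg fun _ => sq_nonneg _)]
  simpa only [h2] using h1

/-! ### Linearity, law and construction of Wiener integrals -/

lemma opM_add_ae {f g : ℝ → ℝ} (hf : MemL2H H f) (hg : MemL2H H g) :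
    opM H (f + g) =ᵐ[volume] opM H f + opM H g := by
  filter_upwards [hf.integrable, hg.integrable] with x h1 h2
  simp only [opM, Pi.add_apply, add_div]
  rw [integral_add h1 h2, mul_add]

lemma opM_smul (H a : ℝ) (f : ℝ → ℝ) : opM H (a • f) = a • opM H f := by
  ext x
  simp only [opM, Pi.smul_apply, smul_eq_mul, mul_div_assoc, integral_const_mul]
  ring

lemma MemL2H.add {f g : ℝ → ℝ} (hf : MemL2H H f) (hg : MemL2H H g) : MemL2H H (f + g) where
  integrable := by
    filter_upwards [hf.integrable, hg.integrable] with x h1 h2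
    simp only [Pi.add_apply, add_div]
    exact h1.add h2
  memLp := (memLp_congr_ae (opM_add_ae hf hg)).2 (hf.memLp.add hg.memLp)

lemma MemL2H.const_smul {f : ℝ → ℝ} (hf : MemL2H H f) (a : ℝ) : MemL2H H (a • f) where
  integrable := by
    filter_upwards [hf.integrable] with x h1
    simpa only [Pi.smul_apply, smul_eq_mul, mul_div_assoc] using h1.const_mul a
  memLp := by
    rw [opM_smul]
    exact hf.memLp.const_smul a

lemma MemL2H.sub {f g : ℝ → ℝ} (hf : MemL2H H f) (hg : MemL2H H g) : MemL2H H (f - g) := by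
  have := hf.add (hg.const_smul (-1))
  simpa [sub_eq_add_neg] using this

lemma opM_sub_ae {f g : ℝ → ℝ} (hf : MemL2H H f) (hg : MemL2H H g) :
    opM H (f - g) =ᵐ[volume] opM H f - opM H g := by
  have := opM_add_ae hf (hg.const_smul (-1))
  rw [opM_smul] at this
  simpa [sub_eq_add_neg] using this

lemma IsWienerIntegral.zero (hH : 1 / 2 < H) (hH' : H < 1) :
    IsWienerIntegral H B P 0 (0 : Ω → ℝ) where
  memL2H := IsTame.zero.memL2H hH hH'
  memLp := MemLp.zero
  exists_approx := by
    have h1 : (opM H fun _ => 0) = 0 := by ext x; simp [opM]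
    refine ⟨fun _ => 0, ?_, ?_⟩
    · simp [stepFun, h1]
    · simp [stepIntegral]

lemma IsWienerIntegral.add {f g : ℝ → ℝ} {Y Z : Ω → ℝ} (hH : 1 / 2 < H) (hH' : H < 1)
    (hB : IsFractionalBrownianMotion H B P) (hf : IsWienerIntegral H B P f Y)
    (hg : IsWienerIntegral H B P g Z) : IsWienerIntegral H B P (f + g) (Y + Z) where
  memL2H := hf.memL2H.add hg.memL2H
  memLp := hf.memLp.add hg.memLp
  exists_approx := by
    obtain ⟨c, hc1, hc2⟩ := hf.exists_approx
    obtain ⟨d, hd1, hd2⟩ := hg.exists_approx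
    refine ⟨fun n => c n + d n, ?_, ?_⟩
    · refine tendsto_of_tendsto_of_tendsto_of_le_of_le tendsto_const_nhds
        (by simpa using hc1.add hd1) (fun n => zero_le) fun n => ?_
      have m1 : MemL2H H (stepFun (c n) - f) :=
        ((isTame_stepFun _).memL2H hH hH').sub hf.memL2H
      have m2 : MemL2H H (stepFun (d n) - g) :=
        ((isTame_stepFun _).memL2H hH hH').sub hg.memL2H
      have e : (fun s => stepFun (c n + d n) s - (f + g) s) =
          (stepFun (c n) - f) + (stepFun (d n) - g) := by
        rw [stepFun_add]
        ext s
        simp only [Pi.add_apply, Pi.sub_apply]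
        ring
      rw [e, eLpNorm_congr_ae (opM_add_ae m1 m2)]
      exact eLpNorm_add_le m1.memLp.1 m2.memLp.1 (by norm_num)
    · refine tendsto_of_tendsto_of_tendsto_of_le_of_le tendsto_const_nhds
        (by simpa using hc2.add hd2) (fun n => zero_le) fun n => ?_
      have e : (fun ω => stepIntegral B (c n + d n) ω - (Y + Z) ω) =
          (stepIntegral B (c n) - Y) + (stepIntegral B (d n) - Z) := by
        rw [stepIntegral_add]
        ext s
        simp only [Pi.add_apply, Pi.sub_apply]
        ring
      rw [e]
      exact eLpNorm_add_le ((hB.hasGaussianLaw_stepIntegral _).memLp_two.sub hf.memLp).1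
        ((hB.hasGaussianLaw_stepIntegral _).memLp_two.sub hg.memLp).1 (by norm_num)

lemma IsWienerIntegral.const_smul {f : ℝ → ℝ} {Y : Ω → ℝ}
    (hf : IsWienerIntegral H B P f Y) (a : ℝ) : IsWienerIntegral H B P (a • f) (a • Y) where
  memL2H := hf.memL2H.const_smul a
  memLp := hf.memLp.const_smul a
  exists_approx := by
    obtain ⟨c, hc1, hc2⟩ := hf.exists_approx
    refine ⟨fun n => a • c n, ?_, ?_⟩
    · have e : ∀ n, (fun s => stepFun (a • c n) s - (a • f) s) =
          a • (fun s => stepFun (c n) s - f s) := by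
        intro n
        rw [stepFun_smul]
        ext s
        simp [mul_sub]
      simp_rw [e, opM_smul, eLpNorm_const_smul]
      simpa using ENNReal.Tendsto.const_mul hc1 (Or.inr (by simp))
    · have e : ∀ n, (fun ω => stepIntegral B (a • c n) ω - (a • Y) ω) =
          a • (fun ω => stepIntegral B (c n) ω - Y ω) := by
        intro n
        rw [stepIntegral_smul]
        ext s
        simp [mul_sub]
      simp_rw [e, eLpNorm_const_smul]
      simpa using ENNReal.Tendsto.const_mul hc2 (Or.inr (by simp))

lemma IsWienerIntegral.sum_smul {ι : Type*} (s : Finset ι) (a : ι → ℝ) {F : ι → ℝ → ℝ}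
    {Y : ι → Ω → ℝ} (hH : 1 / 2 < H) (hH' : H < 1) (hB : IsFractionalBrownianMotion H B P)
    (h : ∀ i ∈ s, IsWienerIntegral H B P (F i) (Y i)) :
    IsWienerIntegral H B P (∑ i ∈ s, a i • F i) (∑ i ∈ s, a i • Y i) := by
  classical
  induction s using Finset.induction_on with
  | empty => simpa using IsWienerIntegral.zero hH hH'
  | insert i s hi ih =>
    rw [Finset.sum_insert hi, Finset.sum_insert hi]
    exact ((h i (by simp)).const_smul _).add hH hH' hB (ih fun j hj => h j (by simp [hj]))

/-- The Wiener integral of `f` is a centered Gaussian variable with variance `‖M f‖²`. -/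
lemma IsWienerIntegral.map_eq_gaussianReal [IsProbabilityMeasure P] {f : ℝ → ℝ} {Y : Ω → ℝ}
    (hH : 1 / 2 < H) (hH' : H < 1) (hB : IsFractionalBrownianMotion H B P)
    (hf : IsWienerIntegral H B P f Y) :
    P.map Y = gaussianReal 0 (∫ x, opM H f x ^ 2).toNNReal := by
  obtain ⟨c, hc1, hc2⟩ := hf.exists_approx
  have hm : ∀ n, AEMeasurable (stepIntegral B (c n)) P := fun n =>
    (hB.hasGaussianLaw_stepIntegral (c n)).aemeasurable
  have hd := (tendstoInMeasure_of_tendsto_eLpNorm (by norm_num : (2 : ℝ≥0∞) ≠ 0)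
    (fun n => (hm n).aestronglyMeasurable) hf.memLp.1 hc2).tendstoInDistribution hm
  have hv : Tendsto (fun n => ∫ x, opM H (stepFun (c n)) x ^ 2) atTop
      (𝓝 (∫ x, opM H f x ^ 2)) := by
    refine tendsto_integral_sq (fun n => ((isTame_stepFun (c n)).memL2H hH hH').memLp)
      hf.memL2H.memLp (hc1.congr fun n => ?_)
    exact eLpNorm_congr_ae (opM_sub_ae ((isTame_stepFun (c n)).memL2H hH hH') hf.memL2H)
  have := Measure.isProbabilityMeasure_map (μ := P) hf.memLp.1.aemeasurable
  refine Measure.ext_of_charFun (funext fun t => ?_)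
  have h1 := ProbabilityMeasure.tendsto_iff_tendsto_charFun.1 hd.tendsto t
  refine tendsto_nhds_unique h1 ?_
  simp only [ProbabilityMeasure.coe_mk]
  simp_rw [hB.map_stepIntegral hH hH', charFun_gaussianReal]
  refine (Complex.continuous_exp.tendsto _).comp ?_
  refine tendsto_const_nhds.sub ?_
  refine Tendsto.div_const (Tendsto.mul_const _ ?_) _
  exact (Complex.continuous_ofReal.tendsto _).comp
    ((NNReal.continuous_coe.tendsto _).comp ((continuous_real_toNNReal.tendsto _).comp hv))

lemma IsWienerIntegral.integral_sq [IsProbabilityMeasure P] {f : ℝ → ℝ} {Y : Ω → ℝ}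
    (hH : 1 / 2 < H) (hH' : H < 1) (hB : IsFractionalBrownianMotion H B P)
    (hf : IsWienerIntegral H B P f Y) :
    ∫ ω, Y ω ^ 2 ∂P = ∫ x, opM H f x ^ 2 := by
  obtain ⟨c, hc1, hc2⟩ := hf.exists_approx
  have h1 := tendsto_integral_sq
    (fun n => (hB.hasGaussianLaw_stepIntegral (c n)).memLp_two) hf.memLp hc2
  have h2 := tendsto_integral_sq (fun n => ((isTame_stepFun (c n)).memL2H hH hH').memLp)
      hf.memL2H.memLp (hc1.congr fun n =>
    eLpNorm_congr_ae (opM_sub_ae ((isTame_stepFun (c n)).memL2H hH hH') hf.memL2H))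
  refine tendsto_nhds_unique h1 (h2.congr fun n => ?_)
  rw [hB.integral_stepIntegral_sq hH hH',
    ← integral_opM_mul_opM hH hH' (isTame_stepFun (c n)) (isTame_stepFun (c n))]
  simp_rw [pow_two]

/-- By completeness of `L²(P)`, the Wiener integral exists as soon as the integrand can be
approximated by step functions. -/
lemma exists_isWienerIntegral_of_tendsto (hH : 1 / 2 < H) (hH' : H < 1)
    (hB : IsFractionalBrownianMotion H B P) {f : ℝ → ℝ} (hf : MemL2H H f) {c : ℕ → ℝ≥0 →₀ ℝ}
    (hc : Tendsto (fun n => eLpNorm (opM H (stepFun (c n) - f)) 2 volume) atTop (𝓝 0)) :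
    ∃ Y, IsWienerIntegral H B P f Y := by
  have hs : ∀ n, MemL2H H (stepFun (c n)) := fun n => (isTame_stepFun (c n)).memL2H hH hH'
  have hx : Tendsto (fun n => (hs n).memLp.toLp _) atTop (𝓝 (hf.memLp.toLp _)) := by
    rw [Lp.tendsto_Lp_iff_tendsto_eLpNorm'']
    exact hc.congr fun n => eLpNorm_congr_ae (opM_sub_ae (hs n) hf)
  have hg : ∀ n, MemLp (stepIntegral B (c n)) 2 P := fun n =>
    (hB.hasGaussianLaw_stepIntegral (c n)).memLp_two
  have hcy : CauchySeq fun n => (hg n).toLp _ := by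
    have := hx.cauchySeq
    rw [Metric.cauchySeq_iff] at this ⊢
    intro ε hε
    obtain ⟨N, hN⟩ := this ε hε
    refine ⟨N, fun m hm n hn => ?_⟩
    convert hN m hm n hn using 1
    rw [dist_edist, dist_edist, Lp.edist_toLp_toLp, Lp.edist_toLp_toLp, ← stepIntegral_sub,
      hB.eLpNorm_stepIntegral hH hH', stepFun_sub, eLpNorm_congr_ae (opM_sub_ae (hs m) (hs n))]
  obtain ⟨y, hy⟩ := cauchySeq_tendsto_of_complete hcy
  refine ⟨y, hf, Lp.memLp y, c, hc, ?_⟩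
  rw [Lp.tendsto_Lp_iff_tendsto_eLpNorm'] at hy
  exact hy.congr fun n => eLpNorm_congr_ae ((hg n).coeFn_toLp.sub (EventuallyEq.refl _ _))

end WienerIntegrals

/-! ### Existence of Wiener integrals of bounded functions on the unit interval -/

lemma stepFun_single (t : ℝ≥0) (a x : ℝ) :
    stepFun (Finsupp.single t a) x = a * (Icc (0 : ℝ) (t : ℝ)).indicator (fun _ => 1) x :=
  Finsupp.sum_single_index (by simp)

lemma stepFun_sum {ι : Type*} (s : Finset ι) (c : ι → ℝ≥0 →₀ ℝ) (x : ℝ) :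
    stepFun (∑ i ∈ s, c i) x = ∑ i ∈ s, stepFun (c i) x := by
  have h := congrFun (map_sum (AddMonoidHom.mk' stepFun stepFun_add) c s) x
  rw [Finset.sum_apply] at h
  exact h

/-- The step function with mesh `1 / n` on `[0, 1]` that takes the values of `g` at the right
endpoints. -/
noncomputable def rightStep (g : ℝ → ℝ) (n : ℕ) : ℝ≥0 →₀ ℝ :=
  ∑ i ∈ Finset.range n, (Finsupp.single (((i + 1 : ℕ) : ℝ≥0) / n) (g ((i + 1 : ℕ) / n)) -
    Finsupp.single ((i : ℝ≥0) / n) (g ((i + 1 : ℕ) / n)))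

lemma stepFun_rightStep (g : ℝ → ℝ) (n : ℕ) (x : ℝ) :
    stepFun (rightStep g n) x = ∑ i ∈ Finset.range n, g ((i + 1 : ℕ) / n) *
      ((Icc (0 : ℝ) ((i + 1 : ℕ) / n)).indicator (fun _ => 1) x -
        (Icc (0 : ℝ) (i / n)).indicator (fun _ => 1) x) := by
  rw [rightStep, stepFun_sum]
  refine Finset.sum_congr rfl fun i _ => ?_
  rw [stepFun_sub, Pi.sub_apply, stepFun_single, stepFun_single, mul_sub]
  simp

lemma stepFun_rightStep_of_notMem (g : ℝ → ℝ) {n : ℕ} (hn : 0 < n) {x : ℝ}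
    (hx : x ∉ Icc (0 : ℝ) 1) : stepFun (rightStep g n) x = 0 := by
  have hn' : (0 : ℝ) < n := by exact_mod_cast hn
  rw [stepFun_rightStep]
  refine Finset.sum_eq_zero fun i hi => ?_
  have hi' : ((i + 1 : ℕ) : ℝ) ≤ n := by exact_mod_cast Finset.mem_range.1 hi
  have hi'' : (i : ℝ) ≤ n := by exact_mod_cast (Finset.mem_range.1 hi).le
  have h1 : x ∉ Icc (0 : ℝ) ((i + 1 : ℕ) / n) := fun h =>
    hx ⟨h.1, h.2.trans ((div_le_one hn').2 hi')⟩
  have h2 : x ∉ Icc (0 : ℝ) (i / n) := fun h =>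
    hx ⟨h.1, h.2.trans ((div_le_one hn').2 hi'')⟩
  rw [indicator_of_notMem h1, indicator_of_notMem h2]
  simp

lemma stepFun_rightStep_of_mem (g : ℝ → ℝ) {n : ℕ} (hn : 0 < n) {x : ℝ}
    (hx : x ∈ Ioc (0 : ℝ) 1) :
    ∃ y, |y - x| ≤ 1 / n ∧ stepFun (rightStep g n) x = g y := by
  have hn' : (0 : ℝ) < n := by exact_mod_cast hn
  have hnx : 0 < x * n := mul_pos hx.1 hn'
  obtain ⟨k, hk⟩ : ∃ k, ⌈x * n⌉₊ = k + 1 := Nat.exists_eq_succ_of_ne_zero (Nat.ceil_pos.2 hnx).ne'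
  have hk1 : x * n ≤ (k + 1 : ℕ) := hk ▸ Nat.le_ceil _
  have hk2 : (k : ℝ) < x * n := by
    have := Nat.ceil_lt_add_one hnx.le
    rw [hk] at this
    push_cast at this
    linarith
  have hkn : k < n := by
    have : x * n ≤ n := mul_le_of_le_one_left hn'.le hx.2
    exact_mod_cast hk2.trans_le this
  refine ⟨(k + 1 : ℕ) / n, ?_, ?_⟩
  · have e : ((k + 1 : ℕ) : ℝ) / n - x = ((k + 1 : ℕ) - x * n) / n := by field_simp
    rw [e, abs_of_nonneg (div_nonneg (by linarith) hn'.le)]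
    gcongr
    push_cast
    linarith
  · rw [stepFun_rightStep, Finset.sum_eq_single k]
    · have h1 : x ∈ Icc (0 : ℝ) ((k + 1 : ℕ) / n) := ⟨hx.1.le, (le_div_iff₀ hn').2 hk1⟩
      have h2 : x ∉ Icc (0 : ℝ) (k / n) := fun h => by
        have := (le_div_iff₀ hn').1 h.2
        linarith
      rw [indicator_of_mem h1, indicator_of_notMem h2]
      simp
    · intro i _ hik
      rcases lt_or_gt_of_ne hik with h | h
      · have h' : ((i + 1 : ℕ) : ℝ) ≤ k := by exact_mod_cast h
        have h1 : x ∉ Icc (0 : ℝ) ((i + 1 : ℕ) / n) := fun h => by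
          have := (le_div_iff₀ hn').1 h.2
          linarith
        have h2 : x ∉ Icc (0 : ℝ) (i / n) := fun h => by
          have := (le_div_iff₀ hn').1 h.2
          push_cast at h'
          linarith
        rw [indicator_of_notMem h1, indicator_of_notMem h2]
        simp
      · have h' : ((k + 1 : ℕ) : ℝ) ≤ i := by exact_mod_cast h
        have h1 : x ∈ Icc (0 : ℝ) ((i + 1 : ℕ) / n) :=
          ⟨hx.1.le, (le_div_iff₀ hn').2 (by push_cast at h' hk1 ⊢; linarith)⟩
        have h2 : x ∈ Icc (0 : ℝ) (i / n) := ⟨hx.1.le, (le_div_iff₀ hn').2 (by linarith)⟩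
        rw [indicator_of_mem h1, indicator_of_mem h2]
        simp
    · intro h
      exact absurd (Finset.mem_range.2 hkn) h

lemma IsTame.integrable_sq {f : ℝ → ℝ} (hf : IsTame f) : Integrable fun x => f x ^ 2 := by
  simp_rw [pow_two]
  exact (hf.mul hf).integrable

/-- Step functions are dense in `L²([0, 1])`. -/
lemma exists_stepFun_integral_sq_le {f : ℝ → ℝ} (hf : IsTame f)
    (h0 : ∀ x, x ∉ Icc (0 : ℝ) 1 → f x = 0) {ε : ℝ} (hε : 0 < ε) :
    ∃ c : ℝ≥0 →₀ ℝ, (∀ x, x ∉ Icc (0 : ℝ) 1 → stepFun c x = 0) ∧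
      ∫ x, (stepFun c x - f x) ^ 2 ≤ ε := by
  have hf2 : MemLp f (ENNReal.ofReal 2) := by
    rw [ENNReal.ofReal_ofNat, memLp_two_iff_integrable_sq hf.aemeasurable.aestronglyMeasurable]
    exact hf.integrable_sq
  obtain ⟨g, hgs, hgε, hgc, hg2⟩ := hf2.exists_hasCompactSupport_integral_rpow_sub_le
    (by norm_num) (show 0 < ε / 4 by positivity)
  have hfg : Integrable fun x => (f x - g x) ^ 2 := by
    have := hf2.sub hg2
    rw [ENNReal.ofReal_ofNat, memLp_two_iff_integrable_sq this.1] at this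
    exact this
  have hgε' : ∫ x, (f x - g x) ^ 2 ≤ ε / 4 := by simpa using hgε
  have huc := hgc.uniformContinuous_of_tendsto_cocompact (x := 0)
    (hgs.is_zero_at_infty)
  obtain ⟨δ, hδ, hgδ⟩ := Metric.uniformContinuous_iff.1 huc (√(ε / 4)) (by positivity)
  obtain ⟨m, hm⟩ := exists_nat_one_div_lt hδ
  set n := m + 1
  have hn : 0 < n := Nat.succ_pos m
  refine ⟨rightStep g n, fun x hx => stepFun_rightStep_of_notMem g hn hx, ?_⟩
  have e1 : ∫ x, (stepFun (rightStep g n) x - f x) ^ 2 =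
      ∫ x in Ioc (0 : ℝ) 1, (stepFun (rightStep g n) x - f x) ^ 2 := by
    rw [← integral_Icc_eq_integral_Ioc, setIntegral_eq_integral_of_forall_compl_eq_zero]
    intro x hx
    rw [stepFun_rightStep_of_notMem g hn hx, h0 x hx]
    simp
  have hi : Integrable fun x => (stepFun (rightStep g n) x - f x) ^ 2 :=
    ((isTame_stepFun (rightStep g n)).sub hf).integrable_sq
  rw [e1]
  calc _ ≤ ∫ x in Ioc (0 : ℝ) 1, (2 * (ε / 4) + 2 * (f x - g x) ^ 2) := by
        refine setIntegral_mono_on hi.integrableOn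
          ((integrable_const _).add (hfg.integrableOn.const_mul 2)) measurableSet_Ioc fun x hx => ?_
        obtain ⟨y, hy1, hy2⟩ := stepFun_rightStep_of_mem g hn hx
        have hd : dist y x < δ := by
          rw [Real.dist_eq]
          refine hy1.trans_lt ?_
          simpa [n] using hm
        have h3 := hgδ hd
        rw [Real.dist_eq] at h3
        have h4 : (g y - g x) ^ 2 ≤ ε / 4 := by
          rw [← sq_abs, ← Real.sq_sqrt (show 0 ≤ ε / 4 by positivity)]
          exact pow_le_pow_left₀ (abs_nonneg _) h3.le 2
        rw [hy2]
        nlinarith [sq_nonneg ((g y - g x) + (f x - g x))]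
    _ = ε / 2 + 2 * ∫ x in Ioc (0 : ℝ) 1, (f x - g x) ^ 2 := by
        rw [integral_add (integrable_const _) (hfg.integrableOn.const_mul 2)]
        congr 1
        · simp
          ring
        · exact integral_const_mul _ _
    _ ≤ ε / 2 + 2 * (ε / 4) := by
        gcongr
        exact (setIntegral_le_integral hfg (Eventually.of_forall fun x => sq_nonneg _)).trans hgε'
    _ = ε := by ring

/-- Existence of the Wiener integral of bounded functions on `[0, 1]`. -/
lemma IsTame.exists_isWienerIntegral {Ω : Type*} [MeasurableSpace Ω] {B : ℝ≥0 → Ω → ℝ}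
    {P : Measure Ω} {H : ℝ} (hH : 1 / 2 < H) (hH' : H < 1)
    (hB : IsFractionalBrownianMotion H B P) {f : ℝ → ℝ} (hf : IsTame f)
    (h0 : ∀ x, x ∉ Icc (0 : ℝ) 1 → f x = 0) : ∃ Y, IsWienerIntegral H B P f Y := by
  choose c hc1 hc2 using fun n : ℕ =>
    exists_stepFun_integral_sq_le hf h0 (ε := 1 / (n + 1)) (by positivity)
  refine exists_isWienerIntegral_of_tendsto hH hH' hB (hf.memL2H hH hH') (c := c) ?_
  have hlim : Tendsto (fun n : ℕ => ENNReal.ofReal (√(2 * H * (1 / ((n : ℝ) + 1))))) atTop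
      (𝓝 0) := by
    have h1 := (tendsto_one_div_add_atTop_nhds_zero_nat (𝕜 := ℝ)).const_mul (2 * H)
    have h2 := (Real.continuous_sqrt.tendsto _).comp h1
    have h3 := (ENNReal.continuous_ofReal.tendsto _).comp h2
    simpa [Function.comp_def] using h3
  refine tendsto_of_tendsto_of_tendsto_of_le_of_le tendsto_const_nhds hlim (fun n => zero_le)
    fun n => ?_
  have ht : IsTame (stepFun (c n) - f) := (isTame_stepFun _).sub hf
  simp only []
  rw [eLpNorm_two_eq (ht.memL2H hH hH').memLp]
  refine ENNReal.ofReal_le_ofReal (Real.sqrt_le_sqrt ?_)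
  have h1 := covForm_self_le hH hH' ht zero_le_one fun x hx => by
    rw [Pi.sub_apply, hc1 n x hx, h0 x hx, sub_zero]
  rw [← integral_opM_mul_opM hH hH' ht ht, sub_zero, Real.one_rpow, mul_one] at h1
  simp_rw [pow_two] at h1 ⊢
  refine h1.trans ?_
  have h2 := hc2 n
  simp_rw [pow_two] at h2
  exact mul_le_mul_of_nonneg_left h2 (by linarith)

/-! ### Weighted sums of centered squared Gaussian variables -/

/-- A product of complex numbers of norm at most `1` is Lipschitz in its factors. -/
lemma norm_prod_sub_prod_le_sum {ι : Type*} (s : Finset ι) {a b : ι → ℂ} (ha : ∀ i ∈ s, ‖a i‖ ≤ 1)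
    (hb : ∀ i ∈ s, ‖b i‖ ≤ 1) : ‖∏ i ∈ s, a i - ∏ i ∈ s, b i‖ ≤ ∑ i ∈ s, ‖a i - b i‖ := by
  classical
  induction s using Finset.induction_on with
  | empty => simp
  | insert i s hi ih =>
    rw [Finset.prod_insert hi, Finset.prod_insert hi, Finset.sum_insert hi]
    have h1 := ih (fun j hj => ha j (by simp [hj])) (fun j hj => hb j (by simp [hj]))
    have h2 : ‖∏ j ∈ s, b j‖ ≤ 1 := by
      rw [norm_prod]
      exact Finset.prod_le_one (fun j _ => norm_nonneg _) fun j hj => hb j (by simp [hj])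
    have e : a i * ∏ j ∈ s, a j - b i * ∏ j ∈ s, b j =
        (a i - b i) * ∏ j ∈ s, b j + a i * (∏ j ∈ s, a j - ∏ j ∈ s, b j) := by ring
    rw [e]
    refine (norm_add_le _ _).trans (add_le_add ?_ ?_)
    · rw [norm_mul]
      exact mul_le_of_le_one_right (norm_nonneg _) h2
    · rw [norm_mul]
      exact (mul_le_of_le_one_left (norm_nonneg _) (ha i (by simp))).trans h1

lemma integral_sq_gaussianReal : ∫ x, x ^ 2 ∂(gaussianReal 0 1) = 1 := by
  have h := variance_fun_id_gaussianReal (μ := 0) (v := 1)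
  rw [variance_of_integral_eq_zero aemeasurable_id' (by simp)] at h
  simpa using h

lemma integral_pow_four_gaussianReal : ∫ x, x ^ 4 ∂(gaussianReal 0 1) = 3 := by
  -- the fourth derivative at `0` of the moment generating function `exp (t² / 2)`
  have h0 : (0 : ℝ) ∈ interior (integrableExpSet id (gaussianReal 0 1)) := by
    simp [integrableExpSet_id_gaussianReal]
  have h := iteratedDeriv_mgf_zero h0 4
  have hm : mgf id (gaussianReal 0 1) = fun t => Real.exp (t ^ 2 / 2) := by
    rw [mgf_id_gaussianReal]
    ext t
    simp
  have hE : ∀ t : ℝ, HasDerivAt (fun t => Real.exp (t ^ 2 / 2)) (Real.exp (t ^ 2 / 2) * t) t := by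
    intro t
    have := ((hasDerivAt_pow 2 t).div_const 2).exp
    simpa using this
  have d1 : deriv (fun t : ℝ => Real.exp (t ^ 2 / 2)) = fun t => t * Real.exp (t ^ 2 / 2) := by
    ext t
    rw [(hE t).deriv, mul_comm]
  have d2 : deriv (fun t : ℝ => t * Real.exp (t ^ 2 / 2)) =
      fun t => (1 + t ^ 2) * Real.exp (t ^ 2 / 2) := by
    ext t
    have h : HasDerivAt (fun t : ℝ => t * Real.exp (t ^ 2 / 2)) _ t :=
      (hasDerivAt_id' t).mul (hE t)
    rw [h.deriv]
    ring
  have d3 : deriv (fun t : ℝ => (1 + t ^ 2) * Real.exp (t ^ 2 / 2)) =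
      fun t => (3 * t + t ^ 3) * Real.exp (t ^ 2 / 2) := by
    ext t
    have h : HasDerivAt (fun t : ℝ => (1 + t ^ 2) * Real.exp (t ^ 2 / 2)) _ t :=
      ((hasDerivAt_pow 2 t).const_add 1).mul (hE t)
    rw [h.deriv]
    push_cast
    ring
  have d4 : deriv (fun t : ℝ => (3 * t + t ^ 3) * Real.exp (t ^ 2 / 2)) =
      fun t => (3 + 6 * t ^ 2 + t ^ 4) * Real.exp (t ^ 2 / 2) := by
    ext t
    have h : HasDerivAt (fun t : ℝ => (3 * t + t ^ 3) * Real.exp (t ^ 2 / 2)) _ t :=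
      (((hasDerivAt_id' t).const_mul 3).add (hasDerivAt_pow 3 t)).mul (hE t)
    rw [h.deriv, Pi.add_apply]
    push_cast
    ring
  rw [hm] at h
  simp only [iteratedDeriv_succ, iteratedDeriv_zero, d1, d2, d3, d4] at h
  simpa using h.symm

/-- The characteristic function of `Z² - 1` for a standard Gaussian variable `Z`. -/
noncomputable def centeredSqCharFun (w : ℝ) : ℂ :=
  ∫ z, Complex.exp ((w * (z ^ 2 - 1) : ℝ) * Complex.I) ∂(gaussianReal 0 1)

lemma norm_centeredSqCharFun_le (w : ℝ) : ‖centeredSqCharFun w‖ ≤ 1 := by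
  refine (norm_integral_le_integral_norm _).trans ?_
  simp only [Complex.norm_exp_ofReal_mul_I]
  simp

lemma integrable_pow_gaussianReal (n : ℕ) : Integrable (fun x : ℝ => x ^ n) (gaussianReal 0 1) := by
  rcases Nat.eq_zero_or_pos n with rfl | hn
  · simp
  · have h := (memLp_id_gaussianReal (μ := 0) (v := 1) (n : ℝ≥0))
    have := h.integrable_norm_pow (p := n) (by exact_mod_cast hn.ne')
    rw [← integrable_norm_iff (by fun_prop)]
    simpa using this

/-- Second order expansion of the characteristic function of `Z² - 1`, whose variance is `2`. -/
lemma centeredSqCharFun_sub_exp_isLittleO :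
    (fun w : ℝ => centeredSqCharFun w - Complex.exp (-(w : ℂ) ^ 2)) =o[𝓝 0] fun w => w ^ 2 := by
  -- normalized to variance `1`, so that the general Taylor expansion of order two applies
  set X : ℝ → ℝ := fun z => (z ^ 2 - 1) / √2 with hX
  have s2 : √2 ≠ 0 := by positivity
  have hXm : Measurable X := by fun_prop
  have i2 := integrable_pow_gaussianReal 2
  have i4 := integrable_pow_gaussianReal 4
  have h0 : (gaussianReal 0 1)[X] = 0 := by
    simp only [hX]
    rw [integral_div, integral_sub i2 (integrable_const _), integral_sq_gaussianReal]
    simp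
  have h1 : (gaussianReal 0 1)[X ^ 2] = 1 := by
    have e : ∀ z, (X ^ 2) z = (z ^ 4 - 2 * z ^ 2 + 1) / 2 := by
      intro z
      simp only [hX, Pi.pow_apply, div_pow, Real.sq_sqrt zero_le_two]
      ring
    have i42 : Integrable (fun z : ℝ => z ^ 4 - 2 * z ^ 2) (gaussianReal 0 1) :=
      i4.sub (i2.const_mul 2)
    simp_rw [e]
    rw [integral_div, integral_add i42 (integrable_const _),
      integral_sub i4 (i2.const_mul 2), integral_const_mul, integral_pow_four_gaussianReal,
      integral_sq_gaussianReal]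
    simp
    norm_num
  have ht := taylor_charFun_two hXm.aemeasurable h0 h1
  have hc : ∀ w : ℝ, charFun ((gaussianReal 0 1).map X) (√2 * w) = centeredSqCharFun w := by
    intro w
    rw [charFun_apply_real, integral_map hXm.aemeasurable (by fun_prop), centeredSqCharFun]
    congr 1
    ext z
    congr 2
    rw [← Complex.ofReal_mul]
    congr 1
    simp only [hX]
    field_simp
  have hlim : Tendsto (fun w : ℝ => √2 * w) (𝓝 0) (𝓝 0) := by
    have : Continuous fun w : ℝ => √2 * w := by fun_prop
    simpa using this.tendsto 0
  have h3 : (fun w : ℝ => centeredSqCharFun w - (1 - (w : ℂ) ^ 2)) =o[𝓝 0] fun w => w ^ 2 := by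
    have h4 := ht.comp_tendsto hlim
    have h5 : ((fun t : ℝ => t ^ 2) ∘ fun w : ℝ => √2 * w) =O[𝓝 0] fun w : ℝ => w ^ 2 := by
      refine Asymptotics.isBigO_of_le' (c := 2) _ fun w => ?_
      simp [mul_pow]
    refine (h4.trans_isBigO h5).congr_left fun w => ?_
    simp only [Function.comp_apply, hc]
    push_cast
    rw [mul_pow, ← Complex.ofReal_pow √2, Real.sq_sqrt zero_le_two]
    push_cast
    ring
  have h6 : (fun w : ℝ => Complex.exp (-(w : ℂ) ^ 2) - (1 - (w : ℂ) ^ 2)) =o[𝓝 0]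
      fun w => w ^ 2 := by
    have hl : Tendsto (fun w : ℝ => -(w : ℂ) ^ 2) (𝓝 0) (𝓝 0) := by
      have : Continuous fun w : ℝ => -(w : ℂ) ^ 2 := by fun_prop
      simpa using this.tendsto 0
    have h7 : (fun z : ℂ => Complex.exp z - 1 - z) =o[𝓝 0] fun z => z := by
      have := (Complex.hasDerivAt_exp 0).isLittleO
      simpa using this
    have h8 := h7.comp_tendsto hl
    have h9 : ((fun z : ℂ => z) ∘ fun w : ℝ => -(w : ℂ) ^ 2) =O[𝓝 0] fun w : ℝ => w ^ 2 := by
      refine Asymptotics.isBigO_of_le _ fun w => ?_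
      simp
    refine (h8.trans_isBigO h9).congr_left fun w => ?_
    simp only [Function.comp_apply]
    ring
  refine (h3.sub h6).congr_left fun w => ?_
  ring

/-- A Lindeberg-type limit theorem: if the weights are uniformly small and their squares sum up
to `v / 2` in the limit, then `∑ λᵢ (Zᵢ² - 1)` is asymptotically `N(0, v)`. -/
lemma tendsto_prod_centeredSqCharFun {ι : ℕ → Type*} [∀ n, Fintype (ι n)] (l : ∀ n, ι n → ℝ)
    {m : ℕ → ℝ} (hm : Tendsto m atTop (𝓝 0)) (hl : ∀ n i, |l n i| ≤ m n) {v : ℝ}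
    (hv : Tendsto (fun n => 2 * ∑ i, l n i ^ 2) atTop (𝓝 v)) (t : ℝ) :
    Tendsto (fun n => ∏ i, centeredSqCharFun (t * l n i)) atTop
      (𝓝 (Complex.exp (-(v * t ^ 2 / 2 : ℝ)))) := by
  have hq : ∀ n, ∏ i, Complex.exp (-((t * l n i : ℝ) : ℂ) ^ 2) =
      Complex.exp (-((2 * ∑ i, l n i ^ 2) * t ^ 2 / 2 : ℝ)) := by
    intro n
    rw [← Complex.exp_sum]
    congr 1
    push_cast
    rw [Finset.sum_neg_distrib, mul_div_right_comm, mul_comm (2 : ℂ), mul_div_assoc, div_self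
      two_ne_zero, mul_one, Finset.sum_mul]
    congr 1
    refine Finset.sum_congr rfl fun i _ => ?_
    ring
  have h1 : Tendsto (fun n => ∏ i, Complex.exp (-((t * l n i : ℝ) : ℂ) ^ 2)) atTop
      (𝓝 (Complex.exp (-(v * t ^ 2 / 2 : ℝ)))) := by
    simp_rw [hq]
    refine (Complex.continuous_exp.tendsto _).comp (Tendsto.neg ?_)
    exact (Complex.continuous_ofReal.tendsto _).comp ((hv.mul_const _).div_const _)
  have h2 : Tendsto (fun n => ∏ i, centeredSqCharFun (t * l n i) -
      ∏ i, Complex.exp (-((t * l n i : ℝ) : ℂ) ^ 2)) atTop (𝓝 0) := by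
    have hb : ∀ᶠ n in atTop, 2 * ∑ i, l n i ^ 2 < v + 1 := hv.eventually_lt_const (by linarith)
    have hv0 : 0 ≤ v := ge_of_tendsto' hv fun n => by positivity
    rw [Metric.tendsto_nhds]
    intro ε hε
    -- `K` exceeds the bound `t² (v + 1) / 2` of `∑ (t λᵢ)²`, so that an error `(ε / K) (t λᵢ)²` in
    -- each factor adds up to less than `ε`
    set K := t ^ 2 * (v + 1) / 2 + 1 with hK
    have hK0 : 0 < K := by positivity
    obtain ⟨δ, hδ, hδ'⟩ := Metric.eventually_nhds_iff.1
      (centeredSqCharFun_sub_exp_isLittleO.def (show 0 < ε / K by positivity))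
    have hmt : Tendsto (fun n => |t| * m n) atTop (𝓝 0) := by simpa using hm.const_mul |t|
    filter_upwards [hb, hmt.eventually_lt_const hδ] with n hn1 hn2
    rw [dist_zero_right]
    refine (norm_prod_sub_prod_le_sum _ (fun i _ => norm_centeredSqCharFun_le _)
      fun i _ => ?_).trans_lt ?_
    · rw [← Complex.ofReal_pow, ← Complex.ofReal_neg, Complex.norm_exp_ofReal]
      exact Real.exp_le_one_iff.2 (by nlinarith [sq_nonneg (t * l n i)])
    calc ∑ i, ‖centeredSqCharFun (t * l n i) - Complex.exp (-((t * l n i : ℝ) : ℂ) ^ 2)‖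
        ≤ ∑ i, ε / K * (t * l n i) ^ 2 := by
          refine Finset.sum_le_sum fun i _ => ?_
          have hd : dist (t * l n i) 0 < δ := by
            rw [dist_zero_right, Real.norm_eq_abs, abs_mul]
            exact (mul_le_mul_of_nonneg_left (hl n i) (abs_nonneg t)).trans_lt hn2
          have := hδ' hd
          rwa [Real.norm_of_nonneg (sq_nonneg (t * l n i))] at this
      _ = ε / K * (t ^ 2 * (2 * ∑ i, l n i ^ 2) / 2) := by
          rw [← Finset.mul_sum]
          simp_rw [mul_pow]
          rw [← Finset.mul_sum]
          ring
      _ ≤ ε / K * (t ^ 2 * (v + 1) / 2) := by gcongr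
      _ < ε / K * K := by
          have : 0 < ε / K := by positivity
          exact mul_lt_mul_of_pos_left (by linarith) this
      _ = ε := by field_simp
  simpa using h2.add h1

/-! ### Squared norms of Gaussian vectors -/

open Matrix in
lemma dotProduct_mulVec_eq_sum {ι : Type*} [Fintype ι] (S : Matrix ι ι ℝ) (a : ι → ℝ) :
    a ⬝ᵥ S *ᵥ a = ∑ k, ∑ l, a k * a l * S k l := by
  simp only [dotProduct, Matrix.mulVec, Finset.mul_sum]
  refine Finset.sum_congr rfl fun k _ => Finset.sum_congr rfl fun l _ => ?_
  ring

section QuadraticForm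

variable {ι : Type*} [Fintype ι] [DecidableEq ι] {S : Matrix ι ι ℝ}

open Matrix in
/-- The spectral decomposition of a quadratic form. -/
lemma dotProduct_mulVec_eq_sum_eigenvalues (hS : S.IsHermitian) (t : EuclideanSpace ℝ ι) :
    (t : ι → ℝ) ⬝ᵥ S *ᵥ t = ∑ i, hS.eigenvalues i * inner ℝ (hS.eigenvectorBasis i) t ^ 2 := by
  set b := hS.eigenvectorBasis
  have h1 : S *ᵥ (t : ι → ℝ) =
      ∑ i, inner ℝ (b i) t • (hS.eigenvalues i • (b i : ι → ℝ)) := by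
    conv_lhs => rw [← b.sum_repr' t]
    rw [WithLp.ofLp_sum, Matrix.mulVec_sum]
    refine Finset.sum_congr rfl fun i _ => ?_
    rw [WithLp.ofLp_smul, Matrix.mulVec_smul, hS.mulVec_eigenvectorBasis]
  rw [h1, dotProduct_sum]
  refine Finset.sum_congr rfl fun i _ => ?_
  rw [dotProduct_smul, dotProduct_smul, smul_eq_mul, smul_eq_mul]
  have : (t : ι → ℝ) ⬝ᵥ (b i : ι → ℝ) = inner ℝ (b i) t := by
    simp [PiLp.inner_apply, dotProduct]
  rw [this]
  ring

open Matrix in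
lemma eigenvalues_eq_dotProduct (hS : S.IsHermitian) (i : ι) :
    hS.eigenvalues i =
      (hS.eigenvectorBasis i : ι → ℝ) ⬝ᵥ S *ᵥ (hS.eigenvectorBasis i : ι → ℝ) := by
  have := hS.eigenvalues_eq i
  simpa using this

lemma sum_sq_eigenvectorBasis (hS : S.IsHermitian) (i : ι) :
    ∑ k, hS.eigenvectorBasis i k ^ 2 = 1 := by
  rw [← EuclideanSpace.real_norm_sq_eq, OrthonormalBasis.norm_eq_one, one_pow]

/-- The Hilbert–Schmidt norm in terms of the eigenvalues. -/
lemma sum_sq_eigenvalues (hS : S.IsHermitian) :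
    ∑ i, hS.eigenvalues i ^ 2 = ∑ k, ∑ l, S k l ^ 2 := by
  set b := hS.eigenvectorBasis with hb
  have h1 : ∀ i, hS.eigenvalues i ^ 2 =
      ∑ k, inner ℝ (b i) (WithLp.toLp 2 (S k) : EuclideanSpace ℝ ι) ^ 2 := by
    intro i
    have e : ∀ k, inner ℝ (b i) (WithLp.toLp 2 (S k) : EuclideanSpace ℝ ι) =
        hS.eigenvalues i * b i k := by
      intro k
      have := congrFun (hS.mulVec_eigenvectorBasis i) k
      simpa [PiLp.inner_apply, Matrix.mulVec, dotProduct, hb] using this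
    simp_rw [e, mul_pow]
    rw [← Finset.mul_sum, hb, sum_sq_eigenvectorBasis, mul_one]
  simp_rw [h1]
  rw [Finset.sum_comm]
  refine Finset.sum_congr rfl fun k _ => ?_
  rw [b.sum_sq_inner_right, EuclideanSpace.real_norm_sq_eq]

variable {Ω : Type*} [MeasurableSpace Ω] {P : Measure Ω} [IsProbabilityMeasure P]
  {η : ι → Ω → ℝ}

open Matrix in
/-- A centered Gaussian vector with covariance matrix `S` has the law of `∑ √λᵢ Zᵢ bᵢ`, where
`bᵢ` is an orthonormal basis of eigenvectors with eigenvalues `λᵢ`. -/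
lemma map_toLp_eq_map_pi (hS : S.IsHermitian) (h0 : ∀ i, 0 ≤ hS.eigenvalues i)
    (hη : ∀ k, AEMeasurable (η k) P)
    (hlaw : ∀ a : ι → ℝ, P.map (∑ k, a k • η k) = gaussianReal 0 (a ⬝ᵥ S *ᵥ a).toNNReal) :
    P.map (fun ω => (WithLp.toLp 2 fun k => η k ω : EuclideanSpace ℝ ι)) =
      (Measure.pi fun _ : ι => gaussianReal 0 1).map
        fun x => ∑ i, (√(hS.eigenvalues i) * x i) • hS.eigenvectorBasis i := by
  set b := hS.eigenvectorBasis
  have hm : AEMeasurable (fun ω => (WithLp.toLp 2 fun k => η k ω : EuclideanSpace ℝ ι)) P :=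
    (WithLp.measurable_toLp 2 _).comp_aemeasurable (aemeasurable_pi_lambda _ hη)
  have := Measure.isProbabilityMeasure_map hm
  have hm2 : Measurable fun x : ι → ℝ => ∑ i, (√(hS.eigenvalues i) * x i) • b i := by fun_prop
  have := Measure.isProbabilityMeasure_map (μ := Measure.pi fun _ : ι => gaussianReal 0 1)
    hm2.aemeasurable
  refine Measure.ext_of_charFun (funext fun t => ?_)
  have hq : 0 ≤ (t : ι → ℝ) ⬝ᵥ S *ᵥ t := by
    rw [dotProduct_mulVec_eq_sum_eigenvalues hS]
    exact Finset.sum_nonneg fun i _ => mul_nonneg (h0 i) (sq_nonneg _)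
  have hl : charFun (P.map (fun ω => (WithLp.toLp 2 fun k => η k ω : EuclideanSpace ℝ ι))) t =
      Complex.exp (-(((t : ι → ℝ) ⬝ᵥ S *ᵥ t) / 2 : ℝ)) := by
    have h1 : charFun (P.map (∑ k, t k • η k)) 1 =
        charFun (P.map (fun ω => (WithLp.toLp 2 fun k => η k ω : EuclideanSpace ℝ ι))) t := by
      rw [charFun_apply, charFun_apply, integral_map hm (by fun_prop),
        integral_map (Finset.aemeasurable_sum _ fun k _ => (hη k).const_smul _) (by fun_prop)]
      simp [PiLp.inner_apply]
    rw [← h1, hlaw, charFun_gaussianReal]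
    simp [Real.coe_toNNReal _ hq]
  rw [hl, charFun_apply, integral_map hm2.aemeasurable (by fun_prop)]
  have e : ∀ x : ι → ℝ, Complex.exp
      ((inner ℝ (∑ i, (√(hS.eigenvalues i) * x i) • b i) t : ℝ) * Complex.I) =
      ∏ i, Complex.exp (((√(hS.eigenvalues i) * inner ℝ (b i) t : ℝ) : ℂ) * x i * Complex.I) := by
    intro x
    rw [← Complex.exp_sum, sum_inner]
    congr 1
    push_cast
    rw [Finset.sum_mul]
    refine Finset.sum_congr rfl fun i _ => ?_
    rw [real_inner_smul_left]
    push_cast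
    ring
  simp_rw [e]
  rw [integral_fintype_prod_eq_prod (f := fun (i : ι) (x : ℝ) =>
    Complex.exp (((√(hS.eigenvalues i) * inner ℝ (b i) t : ℝ) : ℂ) * x * Complex.I))]
  simp_rw [← charFun_apply_real, charFun_gaussianReal]
  rw [← Complex.exp_sum, dotProduct_mulVec_eq_sum_eigenvalues hS]
  congr 1
  push_cast
  rw [Finset.sum_div, ← Finset.sum_neg_distrib]
  refine Finset.sum_congr rfl fun i _ => ?_
  rw [mul_pow, ← Complex.ofReal_pow √(hS.eigenvalues i), Real.sq_sqrt (h0 i)]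
  simp [b]

open Matrix in
/-- The characteristic function of the centered squared norm of a Gaussian vector. -/
lemma integral_exp_centered_sq (hS : S.IsHermitian) (h0 : ∀ i, 0 ≤ hS.eigenvalues i)
    (hη : ∀ k, AEMeasurable (η k) P)
    (hlaw : ∀ a : ι → ℝ, P.map (∑ k, a k • η k) = gaussianReal 0 (a ⬝ᵥ S *ᵥ a).toNNReal)
    (u : ℝ) :
    ∫ ω, Complex.exp ((u * (∑ k, η k ω ^ 2 - ∑ k, S k k) : ℝ) * Complex.I) ∂P =
      ∏ i, centeredSqCharFun (u * hS.eigenvalues i) := by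
  set b := hS.eigenvectorBasis
  have hm : AEMeasurable (fun ω => (WithLp.toLp 2 fun k => η k ω : EuclideanSpace ℝ ι)) P :=
    (WithLp.measurable_toLp 2 _).comp_aemeasurable (aemeasurable_pi_lambda _ hη)
  have hm2 : Measurable fun x : ι → ℝ => ∑ i, (√(hS.eigenvalues i) * x i) • b i := by fun_prop
  have htr : ∑ k, S k k = ∑ i, hS.eigenvalues i := by
    have := hS.trace_eq_sum_eigenvalues
    simpa [Matrix.trace] using this
  have h1 : ∫ ω, Complex.exp ((u * (∑ k, η k ω ^ 2 - ∑ k, S k k) : ℝ) * Complex.I) ∂P =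
      ∫ y, Complex.exp ((u * (‖y‖ ^ 2 - ∑ k, S k k) : ℝ) * Complex.I)
        ∂(P.map (fun ω => (WithLp.toLp 2 fun k => η k ω : EuclideanSpace ℝ ι))) := by
    rw [integral_map hm (by fun_prop)]
    simp_rw [EuclideanSpace.real_norm_sq_eq]
  rw [h1, map_toLp_eq_map_pi hS h0 hη hlaw, integral_map hm2.aemeasurable (by fun_prop)]
  have e : ∀ x : ι → ℝ, Complex.exp ((u * (‖∑ i, (√(hS.eigenvalues i) * x i) • b i‖ ^ 2 -
      ∑ k, S k k) : ℝ) * Complex.I) =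
      ∏ i, Complex.exp (((u * hS.eigenvalues i) * (x i ^ 2 - 1) : ℝ) * Complex.I) := by
    intro x
    rw [← Complex.exp_sum, ← Finset.sum_mul, ← Complex.ofReal_sum]
    congr 3
    rw [← b.sum_sq_inner_right, htr]
    simp_rw [b.orthonormal.inner_right_fintype, mul_pow, Real.sq_sqrt (h0 _)]
    rw [← Finset.sum_sub_distrib, Finset.mul_sum]
    refine Finset.sum_congr rfl fun i _ => ?_
    ring
  simp_rw [e]
  rw [integral_fintype_prod_eq_prod (f := fun (i : ι) (x : ℝ) =>
    Complex.exp (((u * hS.eigenvalues i) * (x ^ 2 - 1) : ℝ) * Complex.I))]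
  rfl

end QuadraticForm

open Matrix in
/-- Central limit theorem for the squared norms of a sequence of centered Gaussian vectors: it
holds when the scaled variances converge and the largest eigenvalue of the scaled covariance
matrix is negligible. -/
theorem tendstoInDistribution_centered_sq {ι : ℕ → Type*} [∀ n, Fintype (ι n)]
    {Ω : Type*} [MeasurableSpace Ω] {P : Measure Ω} [IsProbabilityMeasure P]
    {η : ∀ n, ι n → Ω → ℝ} (hη : ∀ n k, AEMeasurable (η n k) P)
    {S : ∀ n, Matrix (ι n) (ι n) ℝ} (hS : ∀ n, (S n).IsHermitian)
    (hlaw : ∀ n (a : ι n → ℝ),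
      P.map (∑ k, a k • η n k) = gaussianReal 0 (a ⬝ᵥ S n *ᵥ a).toNNReal)
    (hpos : ∀ n (a : ι n → ℝ), 0 ≤ a ⬝ᵥ S n *ᵥ a)
    {L : ℕ → ℝ} (hL : ∀ n (a : ι n → ℝ), a ⬝ᵥ S n *ᵥ a ≤ L n * ∑ k, a k ^ 2)
    {r : ℕ → ℝ} (hr : ∀ n, 0 ≤ r n) (hrL : Tendsto (fun n => r n * L n) atTop (𝓝 0)) {v : ℝ≥0}
    (hv : Tendsto (fun n => r n ^ 2 * (2 * ∑ k, ∑ l, S n k l ^ 2)) atTop (𝓝 (v : ℝ))) :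
    TendstoInDistribution (fun n ω => r n * (∑ k, η n k ω ^ 2 - ∑ k, S n k k)) atTop id
      (fun _ => P) (gaussianReal 0 v) := by
  classical
  have h0 : ∀ n i, 0 ≤ (hS n).eigenvalues i := fun n i => by
    rw [eigenvalues_eq_dotProduct]
    exact hpos n _
  have h1 : ∀ n i, (hS n).eigenvalues i ≤ L n := fun n i => by
    rw [eigenvalues_eq_dotProduct]
    refine (hL n _).trans ?_
    rw [sum_sq_eigenvectorBasis, mul_one]
  have hm : ∀ n, AEMeasurable (fun ω => r n * (∑ k, η n k ω ^ 2 - ∑ k, S n k k)) P := by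
    intro n
    have := hη n
    fun_prop
  refine ⟨hm, aemeasurable_id, ?_⟩
  refine ProbabilityMeasure.tendsto_iff_tendsto_charFun.2 fun t => ?_
  simp only [ProbabilityMeasure.coe_mk, Measure.map_id]
  have hc : ∀ n, charFun (P.map fun ω => r n * (∑ k, η n k ω ^ 2 - ∑ k, S n k k)) t =
      ∏ i, centeredSqCharFun (t * (r n * (hS n).eigenvalues i)) := by
    intro n
    rw [charFun_apply_real, integral_map (hm n) (by fun_prop)]
    simp_rw [← mul_assoc t (r n)]
    rw [← integral_exp_centered_sq (hS n) (h0 n) (hη n) (hlaw n)]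
    congr 1
    ext ω
    congr 2
    push_cast
    ring
  simp_rw [hc]
  have := tendsto_prod_centeredSqCharFun (fun n i => r n * (hS n).eigenvalues i) hrL
    (fun n i => by
      rw [abs_of_nonneg (mul_nonneg (hr n) (h0 n i))]
      exact mul_le_mul_of_nonneg_left (h1 n i) (hr n)) (v := v)
    (hv.congr fun n => by
      simp_rw [mul_pow]
      rw [← Finset.mul_sum, sum_sq_eigenvalues]
      ring) t
  rw [charFun_gaussianReal]
  convert this using 3
  simp

/-! ### Covariances over the cells of a grid -/

/-- The `k`-th cell `[k/N, (k+1)/N]` of the grid of mesh `1/N`, for an integer `k`. -/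
def cell (N : ℕ) (k : ℤ) : Set ℝ := Icc ((k : ℝ) / N) (((k : ℝ) + 1) / N)

lemma measurableSet_cell (N : ℕ) (k : ℤ) : MeasurableSet (cell N k) := measurableSet_Icc

lemma isTame_indicator_cell (N : ℕ) (k : ℤ) {τ : ℝ → ℝ} {C : ℝ} (hτ : AEMeasurable τ)
    (hC : ∀ x, |τ x| ≤ C) : IsTame ((cell N k).indicator τ) := by
  refine IsTame.of_le_indicator (C := C) (a := k / N) (b := (k + 1) / N)
    (hτ.indicator (measurableSet_cell N k)) (fun x => ?_)
    (fun x hx => indicator_of_notMem hx _)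
  by_cases hx : x ∈ cell N k
  · rw [indicator_of_mem hx]
    exact hC x
  · rw [indicator_of_notMem hx, abs_zero]
    exact (abs_nonneg _).trans (hC x)

lemma cell_length (N : ℕ) (k : ℤ) : ((k : ℝ) + 1) / N - k / N = 1 / N := by ring

lemma div_le_add_one_div (N : ℕ) (k : ℤ) : (k : ℝ) / N ≤ (k + 1) / N := by
  gcongr
  linarith

/-- The autocovariance of the increments of fractional Brownian motion at unit step. -/
noncomputable def incrCov (H : ℝ) (j : ℤ) : ℝ :=
  (|(j : ℝ) + 1| ^ (2 * H) + |(j : ℝ) - 1| ^ (2 * H) - 2 * |(j : ℝ)| ^ (2 * H)) / 2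

/-- Self-similarity: the form on indicators of cells depends only on their distance. -/
lemma rpow_mul_covForm_cell {H : ℝ} (hH : 1 / 2 < H) (hH' : H < 1) {N : ℕ} (hN : 0 < N)
    (k j : ℤ) :
    (N : ℝ) ^ (2 * H) * covForm H ((cell N k).indicator fun _ => 1)
      ((cell N (k + j)).indicator fun _ => 1) = incrCov H j := by
  have hN' : (0 : ℝ) < N := by exact_mod_cast hN
  have hp : (0 : ℝ) < (N : ℝ) ^ (2 * H) := by positivity
  rw [cell, cell, covForm_indicator_indicator hH hH' (div_le_add_one_div N k)
    (div_le_add_one_div N (k + j)), incrCov]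
  have e : ∀ y : ℝ, |y / N| ^ (2 * H) = |y| ^ (2 * H) / (N : ℝ) ^ (2 * H) := by
    intro y
    rw [abs_div, abs_of_pos hN', Real.div_rpow (abs_nonneg _) hN'.le]
  simp only [← sub_div, e]
  push_cast
  rw [show (k : ℝ) + 1 - (k + j) = -((j : ℝ) - 1) by ring,
    show (k : ℝ) - (k + j + 1) = -((j : ℝ) + 1) by ring,
    show (k : ℝ) + 1 - (k + j + 1) = -(j : ℝ) by ring,
    show (k : ℝ) - (k + j) = -(j : ℝ) by ring, abs_neg, abs_neg, abs_neg]
  field_simp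
  ring

lemma incrCov_eq_covForm {H : ℝ} (hH : 1 / 2 < H) (hH' : H < 1) (j : ℤ) :
    incrCov H j = covForm H ((cell 1 0).indicator fun _ => 1)
      ((cell 1 j).indicator fun _ => 1) := by
  have := rpow_mul_covForm_cell hH hH' one_pos 0 j
  simpa using this.symm

lemma incrCov_nonneg {H : ℝ} (hH : 1 / 2 < H) (hH' : H < 1) (j : ℤ) : 0 ≤ incrCov H j := by
  rw [incrCov_eq_covForm hH hH']
  refine integral_nonneg fun p => mul_nonneg (mul_nonneg ?_ ?_) (covKernel_nonneg hH p) <;>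
  exact indicator_nonneg (fun _ _ => zero_le_one) _

lemma incrCov_neg (H : ℝ) (j : ℤ) : incrCov H (-j) = incrCov H j := by
  simp only [incrCov]
  push_cast
  rw [abs_neg, show -(j : ℝ) + 1 = -((j : ℝ) - 1) by ring,
    show -(j : ℝ) - 1 = -((j : ℝ) + 1) by ring, abs_neg, abs_neg]
  ring

/-- Decay of the autocovariance of the increments. -/
lemma incrCov_add_two_le {H : ℝ} (hH : 1 / 2 < H) (hH' : H < 1) (n : ℕ) :
    incrCov H (n + 2 : ℕ) ≤ H * (2 * H - 1) * ((n : ℝ) + 1) ^ (2 * H - 2) := by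
  rw [incrCov_eq_covForm hH hH']
  set K := H * (2 * H - 1) * ((n : ℝ) + 1) ^ (2 * H - 2) with hK
  have hc : 0 ≤ H * (2 * H - 1) := mul_nonneg (by linarith) (by linarith)
  set u : ℝ → ℝ := (cell 1 0).indicator fun _ => 1 with hu
  set w : ℝ → ℝ := (cell 1 ((n + 2 : ℕ) : ℤ)).indicator fun _ => 1 with hw
  have hut : IsTame u := isTame_indicator_cell 1 0 (C := 1) aemeasurable_const (by simp)
  have hwt : IsTame w := isTame_indicator_cell 1 _ (C := 1) aemeasurable_const (by simp)
  have hI : ∀ k : ℤ, ∫ x, (cell 1 k).indicator (fun _ => (1 : ℝ)) x = 1 := by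
    intro k
    rw [integral_indicator (measurableSet_cell 1 k)]
    simp [cell]
  have h2 : ∫ p : ℝ × ℝ, u p.1 * w p.2 * K = K := by
    rw [integral_mul_const, Measure.volume_eq_prod, integral_prod_mul, hI, hI]
    ring
  rw [← h2, covForm]
  refine integral_mono (integrable_covForm hH hH' hut hwt)
    ((hut.integrable.mul_prod hwt.integrable).mul_const K) fun p => ?_
  simp only [hu, hw]
  by_cases h1 : p.1 ∈ cell 1 0
  · by_cases h3 : p.2 ∈ cell 1 ((n + 2 : ℕ) : ℤ)
    · rw [indicator_of_mem h1, indicator_of_mem h3, one_mul, one_mul, one_mul, covKernel, hK]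
      refine mul_le_mul_of_nonneg_left ?_ hc
      refine Real.rpow_le_rpow_of_nonpos (by positivity) ?_ (by linarith)
      simp only [cell, mem_Icc] at h1 h3
      push_cast at h1 h3
      rw [abs_sub_comm]
      refine le_trans ?_ (le_abs_self _)
      linarith [h1.2, h3.1]
    · rw [indicator_of_notMem h3]
      simp
  · rw [indicator_of_notMem h1]
    simp

/-- The autocovariance is square summable because `2 (2H - 2) < -1` for `H < 3/4`. -/
lemma summable_incrCov_sq {H : ℝ} (hH : 1 / 2 < H) (hH' : H < 3 / 4) :
    Summable fun j : ℤ => incrCov H j ^ 2 := by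
  have h1 : Summable fun n : ℕ => incrCov H (n : ℤ) ^ 2 := by
    rw [← summable_nat_add_iff 2]
    have hs : Summable fun n : ℕ => (H * (2 * H - 1)) ^ 2 * (((n + 1 : ℕ) : ℝ)) ^ (4 * H - 4) :=
      ((summable_nat_add_iff 1).2 (Real.summable_nat_rpow.2 (by linarith))).mul_left _
    refine Summable.of_nonneg_of_le (fun n => sq_nonneg _) (fun n => ?_) hs
    have h := incrCov_add_two_le hH (by linarith) n
    have h2 := pow_le_pow_left₀ (incrCov_nonneg hH (by linarith) _) h 2
    refine h2.trans (le_of_eq ?_)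
    rw [mul_pow, ← Real.rpow_natCast (((n : ℝ) + 1) ^ (2 * H - 2)), ← Real.rpow_mul (by positivity)]
    push_cast
    congr 2
    ring
  refine Summable.of_nat_of_neg h1 ?_
  simpa only [incrCov_neg] using h1

section Pieces

variable {H : ℝ} {τ : ℝ → ℝ} {C : ℝ}

lemma abs_rpow_mul_covForm_le (hH : 1 / 2 < H) (hH' : H < 1)
    (hC : ∀ x, |τ x| ≤ C) {N : ℕ} (hN : 0 < N) (k j : ℤ) :
    |(N : ℝ) ^ (2 * H) * covForm H ((cell N k).indicator τ) ((cell N (k + j)).indicator τ)| ≤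
      C ^ 2 * incrCov H j := by
  have hu : ∀ k, IsTame ((cell N k).indicator fun _ => (1 : ℝ)) := fun k =>
    isTame_indicator_cell N k (C := 1) aemeasurable_const (by simp)
  have hb : ∀ k x, |(cell N k).indicator τ x| ≤
      (C • (cell N k).indicator fun _ => (1 : ℝ)) x := by
    intro k x
    by_cases hx : x ∈ cell N k
    · simpa [hx] using hC x
    · simp [hx]
  have h := abs_covForm_le hH hH' ((hu k).const_smul C) ((hu (k + j)).const_smul C) (hb k)
    (hb (k + j))
  rw [covForm_smul_left, covForm_smul_right] at h
  rw [abs_mul, abs_of_nonneg (by positivity : (0 : ℝ) ≤ (N : ℝ) ^ (2 * H)),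
    ← rpow_mul_covForm_cell hH hH' hN k j]
  refine (mul_le_mul_of_nonneg_left h (by positivity)).trans (le_of_eq ?_)
  ring

/-- Freezing the coefficient at a point costs at most its mean oscillation over the two cells. -/
lemma abs_rpow_mul_covForm_sub_le (hH : 1 / 2 < H) (hH' : H < 1) (hτ : AEMeasurable τ)
    (hC : ∀ x, |τ x| ≤ C) {N : ℕ} (hN : 0 < N) (k j : ℤ) (x : ℝ) :
    |(N : ℝ) ^ (2 * H) * covForm H ((cell N k).indicator τ) ((cell N (k + j)).indicator τ) -
      τ x ^ 2 * incrCov H j| ≤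
      2 * H * C * ((N * ∫ y in cell N k, |τ y - τ x|) +
        N * ∫ y in cell N (k + j), |τ y - τ x|) := by
  have hN' : (0 : ℝ) < N := by exact_mod_cast hN
  have hC0 : 0 ≤ C := (abs_nonneg _).trans (hC x)
  set τ' : ℝ → ℝ := fun y => τ y - τ x with hτ'
  have hτ'm : AEMeasurable τ' := hτ.sub aemeasurable_const
  have hτ'C : ∀ y, |τ' y| ≤ C + C := fun y =>
    (abs_sub _ _).trans (add_le_add (hC y) (hC x))
  set u : ℤ → ℝ → ℝ := fun k => (cell N k).indicator fun _ => (1 : ℝ) with hudef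
  have hu : ∀ k, IsTame (u k) := fun k =>
    isTame_indicator_cell N k (C := 1) aemeasurable_const (by simp)
  have ht : ∀ k, IsTame ((cell N k).indicator τ) := fun k => isTame_indicator_cell N k hτ hC
  have ht' : ∀ k, IsTame ((cell N k).indicator τ') := fun k =>
    isTame_indicator_cell N k hτ'm hτ'C
  have hdec : ∀ k, (cell N k).indicator τ = (cell N k).indicator τ' + τ x • u k := by
    intro k
    ext y
    by_cases hy : y ∈ cell N k <;> simp [hy, hτ', hudef]
  -- a term with the oscillating factor `τ'` is controlled by Schur's test
  have hkey : ∀ (k l : ℤ) (g : ℝ → ℝ), (∀ y, |g y| ≤ (C • u l) y) →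
      |(N : ℝ) ^ (2 * H) * covForm H ((cell N k).indicator τ') g| ≤
        2 * H * C * (N * ∫ y in cell N k, |τ' y|) := by
    intro k l g hg
    have h1 := abs_covForm_le hH hH' (ht' k).abs ((hu l).const_smul C)
      (fun y => le_rfl) hg
    rw [covForm_smul_right] at h1
    have h2 := covForm_indicator_le hH hH' (ht' k).abs (fun y => abs_nonneg _)
      (div_le_add_one_div N l)
    rw [cell_length] at h2
    have e1 : ∫ y, |(cell N k).indicator τ' y| = ∫ y in cell N k, |τ' y| := by
      rw [← integral_indicator (measurableSet_cell N k)]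
      congr 1
      ext y
      by_cases hy : y ∈ cell N k <;> simp [hy]
    rw [e1] at h2
    rw [abs_mul, abs_of_nonneg (by positivity : (0 : ℝ) ≤ (N : ℝ) ^ (2 * H))]
    calc _ ≤ (N : ℝ) ^ (2 * H) *
          (C * (2 * H * (1 / (N : ℝ)) ^ (2 * H - 1) * ∫ y in cell N k, |τ' y|)) := by
          refine mul_le_mul_of_nonneg_left ?_ (by positivity)
          exact h1.trans (mul_le_mul_of_nonneg_left h2 hC0)
      _ = 2 * H * C * (((N : ℝ) ^ (2 * H) * (1 / (N : ℝ)) ^ (2 * H - 1)) *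
            ∫ y in cell N k, |τ' y|) := by ring
      _ = _ := by
          rw [one_div, Real.inv_rpow hN'.le, ← Real.rpow_neg hN'.le, ← Real.rpow_add hN',
            show 2 * H + -(2 * H - 1) = 1 by ring, Real.rpow_one]
  have hb1 : ∀ y, |(cell N (k + j)).indicator τ y| ≤ (C • u (k + j)) y := by
    intro y
    by_cases hy : y ∈ cell N (k + j)
    · simpa [hudef, hy] using hC y
    · simp [hudef, hy]
  have hb2 : ∀ y, |(τ x • u k) y| ≤ (C • u k) y := by
    intro y
    by_cases hy : y ∈ cell N k
    · simpa [hudef, hy] using hC x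
    · simp [hudef, hy]
  have e : (N : ℝ) ^ (2 * H) * covForm H ((cell N k).indicator τ) ((cell N (k + j)).indicator τ) -
      τ x ^ 2 * incrCov H j =
      (N : ℝ) ^ (2 * H) * covForm H ((cell N k).indicator τ') ((cell N (k + j)).indicator τ) +
      (N : ℝ) ^ (2 * H) * covForm H ((cell N (k + j)).indicator τ') (τ x • u k) := by
    rw [← rpow_mul_covForm_cell hH hH' hN k j]
    rw [hdec k, covForm_add_left hH hH' (ht' k) ((hu k).const_smul _) (ht (k + j)),
      covForm_comm H (τ x • u k), hdec (k + j),
      covForm_add_left hH hH' (ht' (k + j)) ((hu (k + j)).const_smul _) ((hu k).const_smul _),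
      covForm_smul_left H (τ x) (u (k + j)), covForm_comm H (u (k + j)),
      covForm_smul_left H (τ x) (u k)]
    ring
  rw [e]
  refine (abs_add_le _ _).trans ?_
  rw [mul_add]
  exact add_le_add (hkey k (k + j) _ hb1) (hkey (k + j) k _ hb2)

end Pieces

/-! ### Convergence of the sum of the squared covariances -/

/-- Functions of the cell index `⌊N x⌋` integrate to averages over the cells of `[0, 1]`. -/
lemma integral_floor_mul_eq_sum (F : ℤ → ℝ) {N : ℕ} (hN : 0 < N) :
    ∫ x in (0 : ℝ)..1, F ⌊N * x⌋ = (∑ k ∈ Finset.range N, F k) / N := by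
  have hN' : (0 : ℝ) < N := by exact_mod_cast hN
  have hle : ∀ k : ℕ, (k : ℝ) / N ≤ ((k + 1 : ℕ) : ℝ) / N := fun k => by
    gcongr
    simp
  have hc : ∀ k : ℕ, ∀ x ∈ Ioo ((k : ℝ) / N) (((k + 1 : ℕ) : ℝ) / N), F ⌊N * x⌋ = F k := by
    intro k x hx
    congr 1
    rw [Int.floor_eq_iff]
    have h1 := (div_lt_iff₀ hN').1 hx.1
    have h2 := (lt_div_iff₀ hN').1 hx.2
    push_cast at h1 h2 ⊢
    constructor <;> linarith
  have hi : ∀ k < N, IntervalIntegrable (fun x : ℝ => F ⌊N * x⌋) volume ((k : ℝ) / N)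
      (((k + 1 : ℕ) : ℝ) / N) := by
    intro k _
    rw [intervalIntegrable_iff_integrableOn_Ioo_of_le (hle k)]
    exact (integrableOn_const (C := F k) (by simp)).congr_fun (fun x hx => (hc k x hx).symm)
      measurableSet_Ioo
  have h := intervalIntegral.sum_integral_adjacent_intervals (f := fun x : ℝ => F ⌊N * x⌋)
    (a := fun k : ℕ => (k : ℝ) / N) (μ := volume) (n := N) hi
  simp only [Nat.cast_zero, zero_div, div_self hN'.ne'] at h
  rw [← h, Finset.sum_div]
  refine Finset.sum_congr rfl fun k _ => ?_
  rw [intervalIntegral.integral_of_le (hle k), integral_Ioc_eq_integral_Ioo,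
    setIntegral_congr_fun measurableSet_Ioo (hc k), setIntegral_const]
  simp only [measureReal_def, Real.volume_Ioo, smul_eq_mul]
  rw [ENNReal.toReal_ofReal (by linarith [hle k])]
  push_cast
  ring

section CellLimits

variable {H : ℝ} {τ : ℝ → ℝ} {C : ℝ}

/-- Cells with index outside `{0, …, N - 1}` meet `[0, 1]` in at most a point. -/
lemma indicator_cell_ae_eq_zero (h0 : ∀ x, x ∉ Icc (0 : ℝ) 1 → τ x = 0) {N : ℕ} (hN : 0 < N)
    {l : ℤ} (hl : l < 0 ∨ (N : ℤ) ≤ l) : (cell N l).indicator τ =ᵐ[volume] 0 := by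
  have hN' : (0 : ℝ) < N := by exact_mod_cast hN
  have hne : ∀ z : ℝ, ∀ᵐ y : ℝ, y ≠ z := fun z =>
    show ({z} : Set ℝ)ᶜ ∈ ae volume from compl_mem_ae_iff.2 (by simp)
  rcases hl with hl | hl
  · have hl' : (l : ℝ) + 1 ≤ 0 := by exact_mod_cast hl
    filter_upwards [hne ((l + 1) / N)] with y hy
    refine indicator_apply_eq_zero.2 fun hyc => h0 y fun hy' => ?_
    have h1 : y < (l + 1) / N := lt_of_le_of_ne hyc.2 hy
    have h2 : ((l : ℝ) + 1) / N ≤ 0 := div_nonpos_of_nonpos_of_nonneg hl' hN'.le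
    linarith [hy'.1]
  · have hl' : (N : ℝ) ≤ l := by exact_mod_cast hl
    filter_upwards [hne (l / N)] with y hy
    refine indicator_apply_eq_zero.2 fun hyc => h0 y fun hy' => ?_
    have h1 : l / N < y := lt_of_le_of_ne hyc.1 (Ne.symm hy)
    have h2 : 1 ≤ (l : ℝ) / N := (one_le_div hN').2 hl'
    linarith [hy'.2]

/-- The square of the covariance, rescaled by `N^{2H}`, of the Wiener integrals of `τ` over two
cells. -/
noncomputable def cellCovSq (H : ℝ) (τ : ℝ → ℝ) (N : ℕ) (k l : ℤ) : ℝ :=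
  ((N : ℝ) ^ (2 * H) * covForm H ((cell N k).indicator τ) ((cell N l).indicator τ)) ^ 2

lemma cellCovSq_nonneg (H : ℝ) (τ : ℝ → ℝ) (N : ℕ) (k l : ℤ) : 0 ≤ cellCovSq H τ N k l :=
  sq_nonneg _

lemma cellCovSq_le (hH : 1 / 2 < H) (hH' : H < 1) (hC : ∀ x, |τ x| ≤ C) {N : ℕ} (hN : 0 < N)
    (k j : ℤ) : cellCovSq H τ N k (k + j) ≤ C ^ 4 * incrCov H j ^ 2 := by
  rw [cellCovSq, ← sq_abs]
  refine (pow_le_pow_left₀ (abs_nonneg _) (abs_rpow_mul_covForm_le hH hH' hC hN k j) 2).trans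
    (le_of_eq ?_)
  ring

/-- Summation along the diagonals of the covariance matrix. The sum over all `j` includes cells
outside `[0, 1]`, which contribute `0` as `τ` vanishes there. -/
lemma tsum_diagonal_eq (h0 : ∀ x, x ∉ Icc (0 : ℝ) 1 → τ x = 0) {N : ℕ} (hN : 0 < N) :
    ∑' j : ℤ, (∑ k ∈ Finset.range N, cellCovSq H τ N k (k + j)) / N =
      (∑ k ∈ Finset.range N, ∑ l ∈ Finset.range N, cellCovSq H τ N k l) / N := by
  have h1 : ∀ k : ℤ, HasSum (fun j : ℤ => cellCovSq H τ N k (k + j))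
      (∑ l ∈ Finset.range N, cellCovSq H τ N k l) := by
    intro k
    have h2 : HasSum (fun l : ℤ => cellCovSq H τ N k l)
        (∑ l ∈ (Finset.range N).map Nat.castEmbedding, cellCovSq H τ N k l) := by
      refine hasSum_sum_of_ne_finset_zero fun l hl => ?_
      have hl' : l < 0 ∨ (N : ℤ) ≤ l := by
        by_contra hcon
        push Not at hcon
        refine hl (Finset.mem_map.2 ⟨l.toNat, ?_, ?_⟩)
        · rw [Finset.mem_range]
          omega
        · simp only [Nat.castEmbedding_apply]
          omega
      rw [cellCovSq, covForm_congr_ae (EventuallyEq.refl _ _)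
        (indicator_cell_ae_eq_zero h0 hN hl'), covForm_comm, covForm_zero_left]
      simp
    have h3 := (Equiv.addLeft k).hasSum_iff.2 h2
    simpa only [Function.comp_def, Equiv.coe_addLeft, Finset.sum_map, Nat.castEmbedding_apply]
      using h3
  exact ((hasSum_sum fun (k : ℕ) _ => h1 k).div_const (N : ℝ)).tsum_eq

/-- By the Lebesgue differentiation theorem, the mean oscillation of `τ` around almost every point
vanishes in the limit along cells at a bounded number of steps. -/
lemma ae_tendsto_cell_oscillation (hτ : LocallyIntegrable τ) (i : ℤ) :
    ∀ᵐ x : ℝ, Tendsto (fun N : ℕ => N * ∫ y in cell N (⌊N * x⌋ + i), |τ y - τ x|) atTop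
      (𝓝 0) := by
  filter_upwards [IsUnifLocDoublingMeasure.ae_tendsto_average_norm_sub volume hτ
    (2 * (|(i : ℝ)| + 1))] with x hx
  -- the cells are balls of radius `1 / (2N)` that need not contain `x`, but whose dilates by
  -- `2 (|i| + 1)` do
  have hpos : ∀ᶠ N : ℕ in atTop, (0 : ℝ) < N := by
    filter_upwards [eventually_gt_atTop 0] with N hN
    exact_mod_cast hN
  have hδ : Tendsto (fun N : ℕ => 1 / (2 * (N : ℝ))) atTop (𝓝[>] 0) := by
    rw [tendsto_nhdsWithin_iff]
    constructor
    · have h := tendsto_one_div_atTop_nhds_zero_nat (𝕜 := ℝ)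
      have h2 := h.const_mul (1 / 2)
      rw [mul_zero] at h2
      refine h2.congr fun N => ?_
      rw [one_div_mul_one_div]
    · filter_upwards [hpos] with N hN
      simp only [mem_Ioi]
      positivity
  have h := hx (fun N : ℕ => ((⌊N * x⌋ + i : ℤ) + 1 / 2 : ℝ) / N) (fun N : ℕ => 1 / (2 * (N : ℝ)))
    hδ ?_
  · refine h.congr' ?_
    filter_upwards [hpos] with N hN
    have hb : Metric.closedBall (((⌊N * x⌋ + i : ℤ) + 1 / 2 : ℝ) / N) (1 / (2 * (N : ℝ))) =
        cell N (⌊N * x⌋ + i) := by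
      rw [Real.closedBall_eq_Icc, cell]
      congr 1 <;> field_simp <;> ring
    rw [hb, setAverage_eq, cell, measureReal_def, Real.volume_Icc, cell_length,
      ENNReal.toReal_ofReal (by positivity)]
    simp
  · filter_upwards [hpos] with N hN
    rw [Metric.mem_closedBall, Real.dist_eq]
    have e : x - ((⌊N * x⌋ + i : ℤ) + 1 / 2 : ℝ) / N =
        ((N * x - ⌊N * x⌋ - 1 / 2) - i) / N := by
      push_cast
      field_simp
      ring
    have h1 := Int.floor_le ((N : ℝ) * x)
    have h2 := Int.lt_floor_add_one ((N : ℝ) * x)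
    have h3 : |(N * x - ⌊N * x⌋ - 1 / 2) - (i : ℝ)| ≤ |(i : ℝ)| + 1 := by
      refine (abs_sub _ _).trans ?_
      have : |N * x - ⌊N * x⌋ - 1 / 2| ≤ 1 := by
        rw [abs_le]
        constructor <;> linarith
      linarith
    rw [e, abs_div, abs_of_pos hN]
    calc _ ≤ (|(i : ℝ)| + 1) / N := by gcongr
      _ = _ := by field_simp

/-- Almost everywhere, the rescaled covariance of cells at distance `j` converges to the
covariance of the increments weighted by `τ²`. -/
lemma ae_tendsto_cellCovSq (hH : 1 / 2 < H) (hH' : H < 1) (hτ : IsTame τ)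
    (hC : ∀ x, |τ x| ≤ C) (j : ℤ) :
    ∀ᵐ x : ℝ, Tendsto (fun N : ℕ => cellCovSq H τ N ⌊N * x⌋ (⌊N * x⌋ + j)) atTop
      (𝓝 (τ x ^ 4 * incrCov H j ^ 2)) := by
  filter_upwards [ae_tendsto_cell_oscillation hτ.integrable.locallyIntegrable 0,
    ae_tendsto_cell_oscillation hτ.integrable.locallyIntegrable j] with x h1 h2
  simp only [add_zero] at h1
  have h3 : Tendsto (fun N : ℕ => (N : ℝ) ^ (2 * H) *
      covForm H ((cell N ⌊N * x⌋).indicator τ) ((cell N (⌊N * x⌋ + j)).indicator τ)) atTop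
      (𝓝 (τ x ^ 2 * incrCov H j)) := by
    rw [tendsto_iff_norm_sub_tendsto_zero]
    have h4 := (h1.add h2).const_mul (2 * H * C)
    simp only [add_zero, mul_zero] at h4
    refine squeeze_zero' (Eventually.of_forall fun N => norm_nonneg _) ?_ h4
    filter_upwards [eventually_gt_atTop 0] with N hN
    exact abs_rpow_mul_covForm_sub_le hH hH' hτ.aemeasurable hC hN _ j x
  have h5 := h3.pow 2
  rw [show τ x ^ 4 * incrCov H j ^ 2 = (τ x ^ 2 * incrCov H j) ^ 2 by ring]
  exact h5

/-- The limit of one diagonal, by dominated convergence. -/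
lemma tendsto_diagonal (hH : 1 / 2 < H) (hH' : H < 1) (hτ : IsTame τ)
    (hC : ∀ x, |τ x| ≤ C) (j : ℤ) :
    Tendsto (fun N : ℕ => (∑ k ∈ Finset.range N, cellCovSq H τ N k (k + j)) / N) atTop
      (𝓝 ((∫ x in (0 : ℝ)..1, τ x ^ 4) * incrCov H j ^ 2)) := by
  have h1 : Tendsto (fun N : ℕ => ∫ x in (0 : ℝ)..1, cellCovSq H τ N ⌊N * x⌋ (⌊N * x⌋ + j)) atTop
      (𝓝 (∫ x in (0 : ℝ)..1, τ x ^ 4 * incrCov H j ^ 2)) := by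
    refine intervalIntegral.tendsto_integral_filter_of_dominated_convergence
      (fun _ => C ^ 4 * incrCov H j ^ 2) ?_ ?_ ?_ ?_
    · refine Eventually.of_forall fun N => ?_
      have hm : Measurable fun x : ℝ => ⌊N * x⌋ := by fun_prop
      exact ((measurable_of_countable
        fun k : ℤ => cellCovSq H τ N k (k + j)).comp hm).aestronglyMeasurable
    · filter_upwards [eventually_gt_atTop 0] with N hN
      refine Eventually.of_forall fun x _ => ?_
      rw [Real.norm_of_nonneg (cellCovSq_nonneg _ _ _ _ _)]
      exact cellCovSq_le hH hH' hC hN _ j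
    · exact intervalIntegrable_const
    · filter_upwards [ae_tendsto_cellCovSq hH hH' hτ hC j] with x hx _
      exact hx
  rw [intervalIntegral.integral_mul_const] at h1
  refine h1.congr' ?_
  filter_upwards [eventually_gt_atTop 0] with N hN
  exact integral_floor_mul_eq_sum (fun k => cellCovSq H τ N k (k + j)) hN

/-- The asymptotic variance: the Riemann-type sum of squared covariances converges. -/
lemma tendsto_sum_cellCovSq (hH : 1 / 2 < H) (hH' : H < 3 / 4) (hτ : IsTame τ)
    (h0 : ∀ x, x ∉ Icc (0 : ℝ) 1 → τ x = 0) :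
    Tendsto (fun N : ℕ =>
        (∑ k ∈ Finset.range N, ∑ l ∈ Finset.range N, cellCovSq H τ N k l) / N) atTop
      (𝓝 (∑' j : ℤ, (∫ x in (0 : ℝ)..1, τ x ^ 4) * incrCov H j ^ 2)) := by
  obtain ⟨C, hC⟩ := hτ.bounded
  have hH1 : H < 1 := by linarith
  have h1 : Tendsto (fun N : ℕ =>
      ∑' j : ℤ, (∑ k ∈ Finset.range N, cellCovSq H τ N k (k + j)) / N) atTop
      (𝓝 (∑' j : ℤ, (∫ x in (0 : ℝ)..1, τ x ^ 4) * incrCov H j ^ 2)) := by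
    refine tendsto_tsum_of_dominated_convergence
      ((summable_incrCov_sq hH hH').mul_left (C ^ 4))
      (fun j => tendsto_diagonal hH hH1 hτ hC j) ?_
    filter_upwards [eventually_gt_atTop 0] with N hN j
    have hN' : (0 : ℝ) < N := by exact_mod_cast hN
    rw [Real.norm_of_nonneg (div_nonneg
      (Finset.sum_nonneg fun k _ => cellCovSq_nonneg _ _ _ _ _) hN'.le), div_le_iff₀ hN']
    calc ∑ k ∈ Finset.range N, cellCovSq H τ N k (k + j)
        ≤ ∑ _k ∈ Finset.range N, C ^ 4 * incrCov H j ^ 2 :=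
          Finset.sum_le_sum fun k _ => cellCovSq_le hH hH1 hC hN k j
      _ = C ^ 4 * incrCov H j ^ 2 * N := by
          rw [Finset.sum_const, Finset.card_range, nsmul_eq_mul, mul_comm]
  refine h1.congr' ?_
  filter_upwards [eventually_gt_atTop 0] with N hN
  exact tsum_diagonal_eq h0 hN

end CellLimits

/-! ### The covariance matrix of the Wiener integrals of the pieces -/

section VolPiece

variable {H : ℝ} {σ : ℝ → ℝ} {C : ℝ} {N : ℕ}

lemma volPiece_eq_indicator_cell (σ : ℝ → ℝ) {N k : ℕ} (hk : k < N) :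
    volPiece σ N k = (cell N k).indicator ((Icc (0 : ℝ) 1).indicator σ) := by
  have hN : (0 : ℝ) < N := by exact_mod_cast (Nat.zero_le k).trans_lt hk
  have hk' : (k : ℝ) + 1 ≤ N := by exact_mod_cast hk
  rw [cell, indicator_indicator, inter_eq_left.2, volPiece, Int.cast_natCast]
  rw [Int.cast_natCast]
  exact Icc_subset_Icc (by positivity) ((div_le_one hN).2 hk')

lemma abs_indicator_Icc_le (hC : ∀ s ∈ Icc (0 : ℝ) 1, |σ s| ≤ C) (x : ℝ) :
    |(Icc (0 : ℝ) 1).indicator σ x| ≤ C := by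
  by_cases hx : x ∈ Icc (0 : ℝ) 1
  · rw [indicator_of_mem hx]
    exact hC x hx
  · rw [indicator_of_notMem hx, abs_zero]
    exact (abs_nonneg _).trans (hC 0 (by simp))

lemma isTame_indicator_unit (hσ : AEMeasurable σ (volume.restrict (Icc (0 : ℝ) 1)))
    (hC : ∀ s ∈ Icc (0 : ℝ) 1, |σ s| ≤ C) : IsTame ((Icc (0 : ℝ) 1).indicator σ) :=
  IsTame.of_le_indicator ((aemeasurable_indicator_iff measurableSet_Icc).2 hσ)
    (abs_indicator_Icc_le hC) fun _ hx => indicator_of_notMem hx _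

lemma isTame_volPiece (hσ : AEMeasurable σ (volume.restrict (Icc (0 : ℝ) 1)))
    (hC : ∀ s ∈ Icc (0 : ℝ) 1, |σ s| ≤ C) {k : ℕ} (hk : k < N) : IsTame (volPiece σ N k) := by
  rw [volPiece_eq_indicator_cell σ hk]
  exact isTame_indicator_cell N k (isTame_indicator_unit hσ hC).aemeasurable
    (abs_indicator_Icc_le hC)

lemma volPiece_eq_zero (σ : ℝ → ℝ) {k : ℕ} (hk : k < N) {x : ℝ} (hx : x ∉ Icc (0 : ℝ) 1) :
    volPiece σ N k x = 0 := by
  rw [volPiece_eq_indicator_cell σ hk, indicator_indicator]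
  exact indicator_of_notMem (fun h => hx h.2) _

/-- Distinct cells overlap in a null set. -/
lemma integral_volPiece_mul_of_ne (σ : ℝ → ℝ) {k l : ℕ} (hkl : k ≠ l) :
    ∫ x, volPiece σ N k x * volPiece σ N l x = 0 := by
  wlog h : k < l generalizing k l
  · simp_rw [mul_comm (volPiece σ N k _)]
    exact this hkl.symm (lt_of_le_of_ne (not_lt.1 h) hkl.symm)
  have hae : ∀ᵐ x : ℝ, x ≠ ((k : ℝ) + 1) / N :=
    show {((k : ℝ) + 1) / N}ᶜ ∈ ae (volume : Measure ℝ) from compl_mem_ae_iff.2 (by simp)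
  refine integral_eq_zero_of_ae ?_
  filter_upwards [hae] with x hx
  have hkl' : (k : ℝ) + 1 ≤ l := by exact_mod_cast h
  by_cases h1 : x ∈ Icc ((k : ℝ) / N) ((k + 1) / N)
  · have h2 : x ∉ Icc ((l : ℝ) / N) ((l + 1) / N) := fun h2 => by
      have h3 : ((k : ℝ) + 1) / N ≤ l / N := by gcongr
      exact hx (le_antisymm h1.2 (h3.trans h2.1))
    simp [volPiece, indicator_of_notMem h2]
  · simp [volPiece, indicator_of_notMem h1]

lemma integral_volPiece_sq_le (hσ : AEMeasurable σ (volume.restrict (Icc (0 : ℝ) 1)))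
    (hC : ∀ s ∈ Icc (0 : ℝ) 1, |σ s| ≤ C) {k : ℕ} (hk : k < N) :
    ∫ x, volPiece σ N k x ^ 2 ≤ C ^ 2 / N := by
  have ht := isTame_volPiece hσ hC hk
  have hind := IsTame.indicator_Icc ((k : ℝ) / N) ((k + 1) / N)
  calc ∫ x, volPiece σ N k x ^ 2
      ≤ ∫ x, C ^ 2 * (Icc ((k : ℝ) / N) ((k + 1) / N)).indicator (fun _ => 1) x := by
        refine integral_mono ht.integrable_sq (hind.integrable.const_mul _) fun x => ?_
        by_cases hx : x ∈ Icc ((k : ℝ) / N) ((k + 1) / N)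
        · have h1 := abs_indicator_Icc_le hC x
          have h2 : volPiece σ N k x = (Icc (0 : ℝ) 1).indicator σ x := by
            rw [volPiece_eq_indicator_cell σ hk, cell, Int.cast_natCast, indicator_of_mem hx]
          simp only [indicator_of_mem hx, mul_one]
          rw [h2, ← sq_abs]
          exact pow_le_pow_left₀ (abs_nonneg _) h1 2
        · simp [volPiece, indicator_of_notMem hx]
    _ = C ^ 2 / N := by
        rw [integral_const_mul, integral_indicator measurableSet_Icc, setIntegral_const,
          measureReal_def, Real.volume_Icc, ← sub_div, add_sub_cancel_left,
          ENNReal.toReal_ofReal (by positivity)]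
        simp [div_eq_mul_inv]

/-- The covariance matrix of the Wiener integrals of the pieces of `σ`. -/
noncomputable def volCov (H : ℝ) (σ : ℝ → ℝ) (N : ℕ) : Matrix (Fin N) (Fin N) ℝ :=
  Matrix.of fun k l => covForm H (volPiece σ N k) (volPiece σ N l)

lemma isHermitian_volCov (H : ℝ) (σ : ℝ → ℝ) (N : ℕ) : (volCov H σ N).IsHermitian := by
  ext k l
  simp [volCov, covForm_comm H (volPiece σ N l)]

open Matrix in
lemma dotProduct_volCov (hH : 1 / 2 < H) (hH' : H < 1)
    (hσ : AEMeasurable σ (volume.restrict (Icc (0 : ℝ) 1)))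
    (hC : ∀ s ∈ Icc (0 : ℝ) 1, |σ s| ≤ C) (a : Fin N → ℝ) :
    a ⬝ᵥ volCov H σ N *ᵥ a =
      covForm H (∑ k, a k • volPiece σ N k) (∑ k, a k • volPiece σ N k) := by
  have ht : ∀ k : Fin N, IsTame (volPiece σ N k) := fun k => isTame_volPiece hσ hC k.2
  rw [dotProduct_mulVec_eq_sum, covForm_sum_left hH hH' _ (fun k _ => (ht k).const_smul _)
    (IsTame.sum _ fun k _ => (ht k).const_smul _)]
  refine Finset.sum_congr rfl fun k _ => ?_
  rw [covForm_smul_left, covForm_comm, covForm_sum_left hH hH' _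
    (fun k _ => (ht k).const_smul _) (ht k), Finset.mul_sum]
  refine Finset.sum_congr rfl fun l _ => ?_
  rw [covForm_smul_left, covForm_comm, volCov, Matrix.of_apply]
  ring

open Matrix in
/-- The largest eigenvalue of the covariance matrix is of order `1 / N`. -/
lemma dotProduct_volCov_le (hH : 1 / 2 < H) (hH' : H < 1)
    (hσ : AEMeasurable σ (volume.restrict (Icc (0 : ℝ) 1)))
    (hC : ∀ s ∈ Icc (0 : ℝ) 1, |σ s| ≤ C) (a : Fin N → ℝ) :
    a ⬝ᵥ volCov H σ N *ᵥ a ≤ 2 * H * C ^ 2 / N * ∑ k, a k ^ 2 := by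
  have ht : ∀ k : Fin N, IsTame (volPiece σ N k) := fun k => isTame_volPiece hσ hC k.2
  have hsum : IsTame (∑ k, a k • volPiece σ N (k : Fin N)) :=
    IsTame.sum _ fun k _ => (ht k).const_smul _
  rw [dotProduct_volCov hH hH' hσ hC]
  refine (covForm_self_le hH hH' hsum zero_le_one fun x hx => ?_).trans ?_
  · rw [Finset.sum_apply]
    exact Finset.sum_eq_zero fun k _ => by simp [volPiece_eq_zero σ k.2 hx]
  -- the pieces are orthogonal in `L²`
  have h1 : ∫ x, (∑ k, a k • volPiece σ N (k : Fin N)) x ^ 2 =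
      ∑ k : Fin N, a k ^ 2 * ∫ x, volPiece σ N k x ^ 2 := by
    have e : ∀ x, (∑ k, a k • volPiece σ N (k : Fin N)) x ^ 2 =
        ∑ k : Fin N, ∑ l : Fin N, a k * a l * (volPiece σ N k x * volPiece σ N l x) := by
      intro x
      rw [Finset.sum_apply, pow_two, Finset.sum_mul_sum]
      refine Finset.sum_congr rfl fun k _ => Finset.sum_congr rfl fun l _ => ?_
      simp only [Pi.smul_apply, smul_eq_mul]
      ring
    have hi : ∀ k l : Fin N, Integrable fun x => volPiece σ N k x * volPiece σ N l x :=
      fun k l => ((ht k).mul (ht l)).integrable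
    simp_rw [e]
    rw [integral_finsetSum _ fun k _ => integrable_finsetSum _ fun l _ => (hi k l).const_mul _]
    refine Finset.sum_congr rfl fun k _ => ?_
    rw [integral_finsetSum _ fun l _ => (hi k l).const_mul _, Finset.sum_eq_single k]
    · rw [integral_const_mul]
      simp_rw [← pow_two]
    · intro l _ hl
      rw [integral_const_mul, integral_volPiece_mul_of_ne σ (fun h => hl (Fin.ext h.symm)),
        mul_zero]
    · simp
  rw [h1, sub_zero, Real.one_rpow, mul_one]
  calc 2 * H * ∑ k : Fin N, a k ^ 2 * ∫ x, volPiece σ N k x ^ 2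
      ≤ 2 * H * ∑ k : Fin N, a k ^ 2 * (C ^ 2 / N) := by
        refine mul_le_mul_of_nonneg_left (Finset.sum_le_sum fun k _ => ?_) (by linarith)
        exact mul_le_mul_of_nonneg_left (integral_volPiece_sq_le hσ hC k.2) (sq_nonneg _)
    _ = _ := by
        rw [← Finset.sum_mul]
        ring

lemma tendsto_rpow_mul_sum_volCov_sq (hH : 1 / 2 < H) (hH' : H < 3 / 4)
    (hσ : AEMeasurable σ (volume.restrict (Icc (0 : ℝ) 1)))
    (hC : ∀ s ∈ Icc (0 : ℝ) 1, |σ s| ≤ C) :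
    Tendsto (fun N : ℕ => (N : ℝ) ^ (4 * H - 1) * (2 * ∑ k, ∑ l, volCov H σ N k l ^ 2)) atTop
      (𝓝 (2 * ∑' j : ℤ,
        (∫ x in (0 : ℝ)..1, (Icc (0 : ℝ) 1).indicator σ x ^ 4) * incrCov H j ^ 2)) := by
  refine ((tendsto_sum_cellCovSq hH hH' (isTame_indicator_unit hσ hC)
    fun x hx => indicator_of_notMem hx _).const_mul 2).congr' ?_
  filter_upwards [eventually_gt_atTop 0] with N hN
  have hN' : (0 : ℝ) < N := by exact_mod_cast hN
  have e : (N : ℝ) ^ (4 * H - 1) = ((N : ℝ) ^ (2 * H)) ^ 2 / N := by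
    rw [Real.rpow_sub_one hN'.ne', ← Real.rpow_natCast, ← Real.rpow_mul hN'.le]
    congr 2
    push_cast
    ring
  rw [e, Finset.sum_range]
  simp_rw [Finset.sum_range]
  simp only [cellCovSq, volCov, Matrix.of_apply, volPiece_eq_indicator_cell σ (Fin.is_lt _),
    mul_pow, ← Finset.mul_sum]
  ring

end VolPiece

/-- The scale `√N N^{2H-1} = N^{2H-1/2}` is negligible with respect to `N`, because `H < 3/4`. -/
lemma tendsto_scale_mul {H : ℝ} (hH : H < 3 / 4) (K : ℝ) :
    Tendsto (fun N : ℕ => √(N : ℝ) * (1 / (N : ℝ)) ^ (1 - 2 * H) * (K / N)) atTop (𝓝 0) := by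
  have h := ((tendsto_rpow_neg_atTop (show 0 < 3 / 2 - 2 * H by linarith)).comp
    tendsto_natCast_atTop_atTop).const_mul K
  rw [mul_zero] at h
  refine h.congr' ?_
  filter_upwards [eventually_gt_atTop 0] with N hN
  have hN' : (0 : ℝ) < N := by exact_mod_cast hN
  simp only [Function.comp_apply]
  rw [Real.sqrt_eq_rpow, one_div (N : ℝ), Real.inv_rpow hN'.le, ← Real.rpow_neg hN'.le,
    ← Real.rpow_add hN', mul_div_assoc', mul_comm _ K, mul_div_assoc,
    ← Real.rpow_sub_one hN'.ne']
  congr 2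
  ring

lemma scale_sq {H : ℝ} (N : ℕ) (hN : 0 < N) :
    (√(N : ℝ) * (1 / (N : ℝ)) ^ (1 - 2 * H)) ^ 2 = (N : ℝ) ^ (4 * H - 1) := by
  have hN' : (0 : ℝ) < N := by exact_mod_cast hN
  rw [mul_pow, Real.sq_sqrt hN'.le, one_div, Real.inv_rpow hN'.le, ← Real.rpow_neg hN'.le,
    ← Real.rpow_natCast, ← Real.rpow_mul hN'.le]
  nth_rewrite 1 [← Real.rpow_one (N : ℝ)]
  rw [← Real.rpow_add hN']
  congr 1
  push_cast
  ring

end FBMVolatility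

theorem theorem2 {Ω : Type*} [MeasurableSpace Ω] (P : Measure Ω) [IsProbabilityMeasure P]
    (H : ℝ) (hH : H ∈ Ioo (1 / 2 : ℝ) (3 / 4))
    (B : ℝ≥0 → Ω → ℝ) (hB : FBMVolatility.IsFractionalBrownianMotion H B P)
    (σ : ℝ → ℝ) (hσ_meas : AEMeasurable σ (volume.restrict (Icc (0 : ℝ) 1)))
    (hσ_bdd : ∃ C : ℝ, ∀ s ∈ Icc (0 : ℝ) 1, |σ s| ≤ C) :
    -- the Wiener integrals `η_k`, `0 ≤ k < N`, exist
    (∀ N k : ℕ, k < N → ∃ Y : Ω → ℝ,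
      FBMVolatility.IsWienerIntegral H B P (FBMVolatility.volPiece σ N k) Y) ∧
    -- the limit defining the asymptotic variance exists, and `X_N` converges to the normal law
    ∃ v : ℝ≥0,
      Tendsto (fun N : ℕ => (N : ℝ) ^ (4 * H - 1) *
          (2 * ∑ k ∈ Finset.range N, ∑ k' ∈ Finset.range N,
            (∫ s : ℝ, FBMVolatility.opM H (FBMVolatility.volPiece σ N k) s *
              FBMVolatility.opM H (FBMVolatility.volPiece σ N k') s) ^ 2))
        atTop (𝓝 (v : ℝ)) ∧
      ∀ η : ℕ → ℕ → Ω → ℝ,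
        (∀ N k : ℕ, k < N →
          FBMVolatility.IsWienerIntegral H B P (FBMVolatility.volPiece σ N k) (η N k)) →
        TendstoInDistribution (fun N : ℕ => FBMVolatility.statX H P η N) atTop id (fun _ => P)
          (gaussianReal 0 v) := by
  obtain ⟨C, hC⟩ := hσ_bdd
  obtain ⟨hH1, hH34⟩ := hH
  have hH2 : H < 1 := by linarith
  have ht : ∀ {N k : ℕ}, k < N → FBMVolatility.IsTame (FBMVolatility.volPiece σ N k) :=
    fun hk => FBMVolatility.isTame_volPiece hσ_meas hC hk
  refine ⟨fun N k hk => (ht hk).exists_isWienerIntegral hH1 hH2 hB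
    fun x hx => FBMVolatility.volPiece_eq_zero σ hk hx, ?_⟩
  set w : ℝ := 2 * ∑' j : ℤ,
    (∫ x in (0 : ℝ)..1, (Icc (0 : ℝ) 1).indicator σ x ^ 4) * FBMVolatility.incrCov H j ^ 2
  have hw : 0 ≤ w := by
    refine mul_nonneg zero_le_two (tsum_nonneg fun j => mul_nonneg ?_ (sq_nonneg _))
    exact intervalIntegral.integral_nonneg zero_le_one fun x _ => by positivity
  have hlim := FBMVolatility.tendsto_rpow_mul_sum_volCov_sq hH1 hH34 hσ_meas hC
  refine ⟨⟨w, hw⟩, hlim.congr fun N => ?_, fun η hη => ?_⟩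
  · simp_rw [Finset.sum_range]
    congr 2
    refine Finset.sum_congr rfl fun k _ => Finset.sum_congr rfl fun l _ => ?_
    rw [FBMVolatility.integral_opM_mul_opM hH1 hH2 (ht k.2) (ht l.2)]
    rfl
  · have hvar : ∀ {N k : ℕ}, k < N → ∫ ω, η N k ω ^ 2 ∂P =
        FBMVolatility.covForm H (FBMVolatility.volPiece σ N k) (FBMVolatility.volPiece σ N k) := by
      intro N k hk
      rw [(hη N k hk).integral_sq hH1 hH2 hB,
        ← FBMVolatility.integral_opM_mul_opM hH1 hH2 (ht hk) (ht hk)]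
      simp_rw [pow_two]
    -- finite linear combinations of the `η_k` are Wiener integrals of linear combinations of the
    -- `f_k`: the `η_k` are jointly Gaussian with covariance matrix `volCov H σ N`
    have hclt := FBMVolatility.tendstoInDistribution_centered_sq (P := P)
      (ι := fun N => Fin N) (η := fun N k => η N k) (S := FBMVolatility.volCov H σ)
      (fun N k => (hη N k k.2).memLp.1.aemeasurable)
      (FBMVolatility.isHermitian_volCov H σ)
      (fun N a => by
        rw [(FBMVolatility.IsWienerIntegral.sum_smul Finset.univ a hH1 hH2 hB
          fun k _ => hη N k k.2).map_eq_gaussianReal hH1 hH2 hB,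
          FBMVolatility.dotProduct_volCov hH1 hH2 hσ_meas hC]
        have hs : FBMVolatility.IsTame (∑ k : Fin N, a k • FBMVolatility.volPiece σ N k) :=
          FBMVolatility.IsTame.sum _ fun k _ => (ht k.2).const_smul _
        rw [← FBMVolatility.integral_opM_mul_opM hH1 hH2 hs hs]
        simp_rw [pow_two])
      (fun N a => by
        have hs : FBMVolatility.IsTame (∑ k : Fin N, a k • FBMVolatility.volPiece σ N k) :=
          FBMVolatility.IsTame.sum _ fun k _ => (ht k.2).const_smul _
        rw [FBMVolatility.dotProduct_volCov hH1 hH2 hσ_meas hC,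
          ← FBMVolatility.integral_opM_mul_opM hH1 hH2 hs hs]
        exact integral_nonneg fun x => mul_self_nonneg _)
      (fun N a => FBMVolatility.dotProduct_volCov_le hH1 hH2 hσ_meas hC a)
      (r := fun N => √(N : ℝ) * (1 / (N : ℝ)) ^ (1 - 2 * H)) (fun N => by positivity)
      (FBMVolatility.tendsto_scale_mul hH34 _) (v := ⟨w, hw⟩)
      (hlim.congr' (by
        filter_upwards [eventually_gt_atTop 0] with N hN
        rw [FBMVolatility.scale_sq N hN]))
    convert hclt using 3 with N ω
    rw [FBMVolatility.statX, FBMVolatility.thetaTilde, ← Finset.mul_sum, ← Finset.mul_sum,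
      ← mul_sub, ← mul_assoc, Finset.sum_range, Finset.sum_range]
    congr 2
    exact Finset.sum_congr rfl fun k _ => hvar k.2
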